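/- An Orlicz function is a convex function $M:[0,\infty)\to[0,\infty)$ with $M(0)=0$ and $M(t)>0$ for $t>0$. Let $\|x\|_M=\inf\{t>0:\sum_{j}M(|x_j|/t)\le 1\}$ be the Luxemburg norm on $\mathbb R^n$, let $\ell_M^n=(\mathbb R^n,\|\cdot\|_M)$, and let $\ell_q^n(\ell_M^n)$ be the space $\mathbb R^{n\times n}$ with the norm $\|a\|=\big(\sum_{i=1}^n\|(a_{ij})_{j=1}^n\|_M^q\big)^{1/q}$. Let $1<q<2$ and $C>0$. Let $M$ be an Orlicz function that is $C^3$ on $(0,\infty)$, satisfies $M'(0)=0$, is normalized, i.e. $\int_0^\infty x\,dM'(x)=1$ ($M'$ being the right derivative), is affine on $[x_0,\infty)$ for some $x_0>0$, and is such that 1. $\lim_{t\to0^+}M''(t)/t^{q-2}$ exists in $[-\infty,\infty]$ (it is then $0$); 2. $\int_0^s \frac{M(t)}{t^q}\frac{dt}{t}\le C\,\frac{M(s)}{s^q}$ for $0<s\le M^{-1}(1)$ (in particular the integral is finite); 3. $f(s):=-\tfrac12 s^{-4}M'''(s^{-1})\ge 0$ for all $s>0$. Then $f$ is a probability density on $(0,\infty)$.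 For every $n$ there are three collections of random variables on $[0,1]$ with Lebesgue measure, the variables in each collection being independent and identically distributed: Rademacher variables $(r_{ij})_{i,j=1}^n$, variables $(\xi_i)_{i=1}^n$ with density $q(q-1)x^{-q-1}\mathbf 1_{[(q-1)^{1/q},\infty)}(x)$, and variables $(X_j)_{j=1}^n$ with density $f$. For every $n$ and all such collections, the formula $$\Psi_n(a)(t,s,u)=\sum_{i,j=1}^n a_{ij}\,r_{ij}(t)\,\xi_i(s)\,X_j(u)$$ defines a bounded linear map $\Psi_n:\ell_q^n(\ell_M^n)\to L_1([0,1]^3)$ with $$c_1\|a\|\le\|\Psi_n(a)\|_{L_1}\le c_2\|a\|\qquad\text{for all } a\in\mathbb R^{n\times n},$$ where $c_1>0$ depends only on $q$ and $c_2>0$ only on $q$ and $C$. Consequently $(\ell_q^n(\ell_M^n))_{n}$ embeds uniformly into $L_1([0,1]^3)$: there is a constant $K>0$ such that for every $n$ there is a subspace $Y_n\subseteq L_1([0,1]^3)$ with $\dim Y_n=n^2$ whose Banach–Mazur distance to $\ell_q^n(\ell_M^n)$, $\inf\|T\|\,\|T^{-1}\|$ over all isomorphisms $T$, is at most $K$.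 -/

import Mathlib

open MeasureTheory ProbabilityTheory Set Filter Topology
open scoped ENNReal NNReal unitInterval

namespace OrliczEmbedding

/-- An Orlicz function: a convex function on `[0, ∞)` that vanishes at `0` and is positive on
`(0, ∞)`. It is stored as a function on `ℝ`, of which only the values on `[0, ∞)` matter. -/
structure OrliczFunction where
  toFun : ℝ → ℝ
  convexOn : ConvexOn ℝ (Ici 0) toFun
  map_zero : toFun 0 = 0
  pos : ∀ t, 0 < t → 0 < toFun t

namespace OrliczFunction

instance : CoeFun OrliczFunction (fun _ => ℝ → ℝ) := ⟨OrliczFunction.toFun⟩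

theorem nonneg (M : OrliczFunction) {t : ℝ} (ht : 0 ≤ t) : 0 ≤ M t := by
  rcases ht.eq_or_lt with rfl | h
  · exact M.map_zero.ge
  · exact (M.pos t h).le

theorem mul_le (M : OrliczFunction) {c t : ℝ} (hc : 0 ≤ c) (hc1 : c ≤ 1) (ht : 0 ≤ t) :
    M (c * t) ≤ c * M t := by
  have h := M.convexOn.2 (x := t) (y := 0) ht (le_refl (0 : ℝ)) hc (sub_nonneg.2 hc1) (by ring)
  simpa [M.map_zero] using h

theorem mono (M : OrliczFunction) {s t : ℝ} (hs : 0 ≤ s) (hst : s ≤ t) : M s ≤ M t := by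
  rcases (hs.trans hst).eq_or_lt with h | h
  · have : s = t := le_antisymm hst (h ▸ hs)
    rw [this]
  · have h1 := M.mul_le (c := s / t) (t := t) (by positivity) ((div_le_one h).2 hst) h.le
    rw [div_mul_cancel₀ _ h.ne'] at h1
    have h2 : s / t * M t ≤ 1 * M t :=
      mul_le_mul_of_nonneg_right ((div_le_one h).2 hst) (M.nonneg h.le)
    linarith

/-- The inverse of an Orlicz function on `[0, ∞)`. -/
noncomputable def inv (M : OrliczFunction) (y : ℝ) : ℝ := sSup {t | 0 ≤ t ∧ M t ≤ y}

/-- The right derivative of an Orlicz function, extended by `0` to `(-∞, 0]`. -/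
noncomputable def rightDeriv (M : OrliczFunction) (x : ℝ) : ℝ :=
  if 0 < x then derivWithin M (Ioi x) x else 0

theorem monotone_rightDeriv (M : OrliczFunction) : Monotone M.rightDeriv := by
  have hmono := M.convexOn.monotoneOn_rightDeriv
  rw [interior_Ici] at hmono
  intro x y hxy
  unfold rightDeriv
  split_ifs with hx hy hy
  · exact hmono hx hy hxy
  · exact absurd (hx.trans_le hxy) hy
  · have hm : MonotoneOn M (Ioi y) := fun a ha b _ hab =>
      M.mono (hy.le.trans (le_of_lt ha)) hab
    exact hm.derivWithin_nonneg
  · exact le_rfl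

/-- The Stieltjes measure `dM'` of the right derivative. -/
noncomputable def stieltjesMeasure (M : OrliczFunction) : Measure ℝ :=
  M.monotone_rightDeriv.stieltjesFunction.measure

/-- `∫₀^∞ x dM'(x) = 1`. -/
def IsNormalized (M : OrliczFunction) : Prop :=
  ∫⁻ x in Ioi (0 : ℝ), ENNReal.ofReal x ∂M.stieltjesMeasure = 1

/-- `f(s) = (1 - 2/p) s⁻³ M''(1/s) - (1/p) s⁻⁴ M'''(1/s)`, for `s > 0`. -/
noncomputable def density (M : OrliczFunction) (p s : ℝ) : ℝ :=
  (1 - 2 / p) * (s ^ 3)⁻¹ * iteratedDeriv 2 M s⁻¹ - 1 / p * (s ^ 4)⁻¹ * iteratedDeriv 3 M s⁻¹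

/-- The measure on `(0, ∞)` with density `M.density p`. -/
noncomputable def law (M : OrliczFunction) (p : ℝ) : Measure ℝ :=
  (volume.restrict (Ioi 0)).withDensity (fun s => ENNReal.ofReal (M.density p s))

/-- The conditions on the Orlicz function, with `C` the constant in the integral condition. -/
structure Admissible (M : OrliczFunction) (p q C : ℝ) : Prop where
  contDiffOn : ContDiffOn ℝ 3 M (Ioi 0)
  normalized : M.IsNormalized
  deriv_zero : HasDerivWithinAt M 0 (Ici 0) 0
  linear : ∃ x₀ > 0, ∃ a b : ℝ, ∀ x, x₀ ≤ x → M x = a * x + b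
  limit : ∃ L : EReal,
    Tendsto (fun t : ℝ => ((iteratedDeriv 2 M t / t ^ (q - 2) : ℝ) : EReal)) (𝓝[>] 0) (𝓝 L)
  integral : ∀ s, 0 < s → s ≤ M.inv 1 →
    IntegrableOn (fun t => M t / t ^ q / t) (Ioc 0 s) ∧
      ∫ t in Ioc 0 s, M t / t ^ q / t ≤ C * (M s / s ^ q)
  density_nonneg : ∀ s, 0 < s → 0 ≤ M.density p s

/-- The Luxemburg norm on `ℝⁿ`. -/
noncomputable def luxemburg (M : OrliczFunction) {n : ℕ} (x : Fin n → ℝ) : ℝ :=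
  sInf {t | 0 < t ∧ ∑ i, M (|x i| / t) ≤ 1}

section Luxemburg

variable (M : OrliczFunction) {n : ℕ}

theorem luxemburg_bddBelow (x : Fin n → ℝ) :
    BddBelow {t | 0 < t ∧ ∑ i, M (|x i| / t) ≤ 1} := ⟨0, fun _ ht => ht.1.le⟩

theorem luxemburg_nonempty (x : Fin n → ℝ) :
    {t | 0 < t ∧ ∑ i, M (|x i| / t) ≤ 1}.Nonempty := by
  have hA : 0 ≤ ∑ i, M |x i| := Finset.sum_nonneg fun i _ => M.nonneg (abs_nonneg _)
  set A := ∑ i, M |x i| with hAdef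
  refine ⟨A + 1, by positivity, ?_⟩
  have h1 : ∀ i ∈ Finset.univ, M (|x i| / (A + 1)) ≤ (A + 1)⁻¹ * M |x i| := fun i _ => by
    rw [div_eq_inv_mul]
    exact M.mul_le (by positivity) (inv_le_one_of_one_le₀ (by linarith)) (abs_nonneg _)
  refine (Finset.sum_le_sum h1).trans ?_
  rw [← Finset.mul_sum, ← hAdef, inv_mul_le_iff₀ (by positivity)]
  linarith

theorem luxemburg_nonneg (x : Fin n → ℝ) : 0 ≤ M.luxemburg x :=
  Real.sInf_nonneg fun _ ht => ht.1.le

theorem luxemburg_add_le (x y : Fin n → ℝ) :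
    M.luxemburg (x + y) ≤ M.luxemburg x + M.luxemburg y := by
  refine le_of_forall_pos_le_add fun ε hε => ?_
  obtain ⟨s, ⟨hs, hsx⟩, hs'⟩ := exists_lt_of_csInf_lt (M.luxemburg_nonempty x)
    (show sInf _ < M.luxemburg x + ε / 2 from lt_add_of_pos_right _ (half_pos hε))
  obtain ⟨t, ⟨ht, hty⟩, ht'⟩ := exists_lt_of_csInf_lt (M.luxemburg_nonempty y)
    (show sInf _ < M.luxemburg y + ε / 2 from lt_add_of_pos_right _ (half_pos hε))
  have hst : 0 < s + t := add_pos hs ht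
  have key : ∀ i ∈ Finset.univ, M (|(x + y) i| / (s + t)) ≤
      s / (s + t) * M (|x i| / s) + t / (s + t) * M (|y i| / t) := fun i _ => by
    have h1 : |(x + y) i| / (s + t) ≤ s / (s + t) * (|x i| / s) + t / (s + t) * (|y i| / t) := by
      have : s / (s + t) * (|x i| / s) + t / (s + t) * (|y i| / t) = (|x i| + |y i|) / (s + t) := by
        field_simp
      rw [this]
      exact div_le_div_of_nonneg_right (abs_add_le _ _) hst.le
    refine (M.mono (by positivity) h1).trans ?_
    exact M.convexOn.2 (x := |x i| / s) (y := |y i| / t)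
      (show (0 : ℝ) ≤ _ by positivity) (show (0 : ℝ) ≤ _ by positivity)
      (by positivity) (by positivity) (by field_simp)
  have hsum : ∑ i, M (|(x + y) i| / (s + t)) ≤ 1 := by
    refine (Finset.sum_le_sum key).trans ?_
    rw [Finset.sum_add_distrib, ← Finset.mul_sum, ← Finset.mul_sum]
    have e1 := mul_le_mul_of_nonneg_left hsx (show 0 ≤ s / (s + t) by positivity)
    have e2 := mul_le_mul_of_nonneg_left hty (show 0 ≤ t / (s + t) by positivity)
    have e3 : s / (s + t) + t / (s + t) = 1 := by field_simp
    linarith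
  have := csInf_le (M.luxemburg_bddBelow (x + y)) ⟨hst, hsum⟩
  change sInf _ ≤ _
  linarith

theorem luxemburg_zero : M.luxemburg (0 : Fin n → ℝ) = 0 := by
  have : {t : ℝ | 0 < t ∧ ∑ i, M (|(0 : Fin n → ℝ) i| / t) ≤ 1} = Ioi 0 := by
    ext t
    simp [M.map_zero]
  rw [luxemburg, this, csInf_Ioi]

theorem luxemburg_smul (c : ℝ) (x : Fin n → ℝ) : M.luxemburg (c • x) = |c| * M.luxemburg x := by
  rcases eq_or_ne c 0 with rfl | hc
  · simp [luxemburg_zero]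
  have hc' : 0 < |c| := abs_pos.2 hc
  rw [luxemburg, luxemburg, ← smul_eq_mul, ← Real.sInf_smul_of_nonneg hc'.le]
  congr 1
  ext t
  rw [Set.mem_smul_set_iff_inv_smul_mem₀ hc'.ne']
  simp only [Set.mem_ofPred_eq, smul_eq_mul, Pi.smul_apply, abs_mul]
  refine and_congr ?_ ?_
  · constructor
    · intro h; positivity
    · intro h; exact pos_of_mul_pos_right h (by positivity)
  · have : ∀ i, |c| * |x i| / t = |x i| / (|c|⁻¹ * t) := fun i => by
      rw [inv_mul_eq_div, div_div_eq_mul_div, mul_comm]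
    simp only [this]

theorem eq_zero_of_luxemburg_eq_zero (x : Fin n → ℝ) (h : M.luxemburg x = 0) : x = 0 := by
  by_contra hx
  obtain ⟨i, hi⟩ := Function.ne_iff.1 hx
  have hu : 0 < |x i| := abs_pos.2 hi
  have hMu := M.pos _ hu
  obtain ⟨t, ⟨ht, htx⟩, ht'⟩ := exists_lt_of_csInf_lt (M.luxemburg_nonempty x)
    (lt_of_eq_of_lt (show sInf _ = (0 : ℝ) from h) (lt_min one_pos hMu))
  have h1 : M (|x i| / t) ≤ 1 := le_trans
    (Finset.single_le_sum (f := fun j => M (|x j| / t))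
      (fun j _ => M.nonneg (by positivity)) (Finset.mem_univ i)) htx
  have h2 := M.mul_le (c := t) (t := |x i| / t) ht.le (ht'.le.trans (min_le_left _ _))
    (by positivity)
  rw [mul_div_cancel₀ _ ht.ne'] at h2
  have h3 := ht'.trans_le (min_le_right 1 (M |x i|))
  nlinarith

end Luxemburg

/-- The Orlicz space `ℓ_M^n`: the vector space `ℝⁿ` with the Luxemburg norm. -/
def Space (_M : OrliczFunction) (n : ℕ) : Type := Fin n → ℝ

noncomputable instance (M : OrliczFunction) (n : ℕ) : AddCommGroup (M.Space n) :=
  inferInstanceAs (AddCommGroup (Fin n → ℝ))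

noncomputable instance (M : OrliczFunction) (n : ℕ) : Module ℝ (M.Space n) :=
  inferInstanceAs (Module ℝ (Fin n → ℝ))

instance (M : OrliczFunction) (n : ℕ) : FiniteDimensional ℝ (M.Space n) :=
  inferInstanceAs (FiniteDimensional ℝ (Fin n → ℝ))

noncomputable instance (M : OrliczFunction) (n : ℕ) : Norm (M.Space n) := ⟨M.luxemburg⟩

theorem space_core (M : OrliczFunction) (n : ℕ) : NormedSpace.Core ℝ (M.Space n) where
  norm_nonneg x := M.luxemburg_nonneg x
  norm_smul c x := M.luxemburg_smul c x
  norm_triangle x y := M.luxemburg_add_le x y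
  norm_eq_zero_iff x := ⟨M.eq_zero_of_luxemburg_eq_zero x, fun h => h ▸ M.luxemburg_zero⟩

noncomputable instance (M : OrliczFunction) (n : ℕ) : NormedAddCommGroup (M.Space n) :=
  NormedAddCommGroup.ofCore (M.space_core n)

noncomputable instance (M : OrliczFunction) (n : ℕ) : NormedSpace ℝ (M.Space n) :=
  NormedSpace.ofCore (M.space_core n)

end OrliczFunction

instance fact_one_le_ofReal (q : ℝ) [hq : Fact (1 < q)] : Fact (1 ≤ ENNReal.ofReal q) :=
  ⟨ENNReal.one_le_ofReal.2 hq.out.le⟩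

/-- The matrix space `ℓ_q^n(ℓ_M^n)`; the norm of `a` is the `ℓ_q`-norm of the vector of the
`ℓ_M`-norms of the rows `(a i j)_j`. -/
abbrev MatrixSpace (q : ℝ) (M : OrliczFunction) (n : ℕ) : Type :=
  PiLp (ENNReal.ofReal q) (fun _ : Fin n => M.Space n)

/-- The law of a Rademacher variable. -/
noncomputable def rademacherLaw : Measure ℝ :=
  (2⁻¹ : ℝ≥0∞) • Measure.dirac 1 + (2⁻¹ : ℝ≥0∞) • Measure.dirac (-1)

/-- The law with density `q (q - 1) x ^ (-q - 1)` on `[(q - 1) ^ (1 / q), ∞)`. -/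
noncomputable def xiLaw (q : ℝ) : Measure ℝ :=
  (volume.restrict (Ici ((q - 1) ^ (1 / q)))).withDensity
    (fun x => ENNReal.ofReal (q * (q - 1) * x ^ (-q - 1)))

/-- Independent collections of i.i.d. random variables on `[0, 1]` with Lebesgue measure:
Rademacher variables `r i j`, variables `ξ i` with law `xiLaw q` and variables `X j` with law
`M.law 2`. -/
structure IsSystem (q : ℝ) (M : OrliczFunction) {n : ℕ} (r : Fin n → Fin n → I → ℝ)
    (ξ X : Fin n → I → ℝ) : Prop where
  measurable_r : ∀ i j, Measurable (r i j)
  measurable_ξ : ∀ i, Measurable (ξ i)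
  measurable_X : ∀ j, Measurable (X j)
  law_r : ∀ i j, HasLaw (r i j) rademacherLaw volume
  law_ξ : ∀ i, HasLaw (ξ i) (xiLaw q) volume
  law_X : ∀ j, HasLaw (X j) (M.law 2) volume
  indep_r : iIndepFun (fun (ij : Fin n × Fin n) => r ij.1 ij.2) volume
  indep_ξ : iIndepFun ξ volume
  indep_X : iIndepFun X volume

/-- The function `(t, s, u) ↦ ∑ i j, a i j * r i j t * ξ i s * X j u` on `[0, 1]³`. -/
noncomputable def psi {q : ℝ} {M : OrliczFunction} {n : ℕ} (r : Fin n → Fin n → I → ℝ)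
    (ξ X : Fin n → I → ℝ) (a : MatrixSpace q M n) (z : I × I × I) : ℝ :=
  ∑ i, ∑ j, a i j * r i j z.1 * ξ i z.2.1 * X j z.2.2

/-- The Banach-Mazur distance; it is `∞` if the spaces are not isomorphic. -/
noncomputable def banachMazurDist (E F : Type*) [NormedAddCommGroup E] [NormedSpace ℝ E]
    [NormedAddCommGroup F] [NormedSpace ℝ F] : ℝ≥0∞ :=
  ⨅ T : E ≃L[ℝ] F, ‖(T : E →L[ℝ] F)‖ₑ * ‖(T.symm : F →L[ℝ] E)‖ₑ

/-- The sequence of finite-dimensional normed spaces `E n` embeds uniformly into `Z`. -/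
def EmbedsUniformly (E : ℕ → Type*) [∀ n, NormedAddCommGroup (E n)] [∀ n, NormedSpace ℝ (E n)]
    [∀ n, FiniteDimensional ℝ (E n)] (Z : Type*) [NormedAddCommGroup Z] [NormedSpace ℝ Z] : Prop :=
  ∃ K : ℝ≥0, 0 < K ∧ ∀ n, ∃ Y : Submodule ℝ Z,
    Module.finrank ℝ Y = Module.finrank ℝ (E n) ∧ banachMazurDist (E n) Y ≤ K

end OrliczEmbedding

open OrliczEmbedding

open OrliczEmbedding

namespace OrliczEmbedding

/-- The function `x ↦ min (x ^ 2) (|x| ^ p)`. -/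
noncomputable def trunc (p x : ℝ) : ℝ := min (x ^ 2) (|x| ^ p)

theorem trunc_nonneg (p x : ℝ) : 0 ≤ trunc p x :=
  le_min (sq_nonneg _) (Real.rpow_nonneg (abs_nonneg _) _)

theorem measurable_trunc (p : ℝ) : Measurable (trunc p) := by
  unfold trunc
  fun_prop

theorem trunc_one_le_abs (x : ℝ) : trunc 1 x ≤ |x| := by
  simp [trunc]

theorem trunc_one_eq (x : ℝ) : trunc 1 x = |x| * min |x| 1 := by
  rw [trunc, Real.rpow_one, mul_min_of_nonneg _ _ (abs_nonneg x), mul_one, ← sq, sq_abs]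

theorem one_add_sum_sq_rpow_le {ι : Type*} {p : ℝ} (hp : 0 ≤ p) (hp2 : p ≤ 2) (s : Finset ι)
    (y : ι → ℝ) : (1 + ∑ i ∈ s, y i ^ 2) ^ (p / 2) ≤ 1 + ∑ i ∈ s, trunc p (y i) := by
  classical
  induction s using Finset.induction_on with
  | empty => simp
  | insert a s ha ih =>
    rw [Finset.sum_insert ha, Finset.sum_insert ha]
    set U := 1 + ∑ i ∈ s, y i ^ 2 with hU
    have hU1 : 1 ≤ U := le_add_of_nonneg_right (Finset.sum_nonneg fun i _ => sq_nonneg _)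
    have hU0 : 0 < U := by linarith
    have e : 1 + (y a ^ 2 + ∑ i ∈ s, y i ^ 2) = U + y a ^ 2 := by rw [hU]; ring
    rw [e]
    suffices h : (U + y a ^ 2) ^ (p / 2) ≤ U ^ (p / 2) + trunc p (y a) by linarith
    rw [trunc, ← min_add_add_left]
    refine le_min ?_ ?_
    · have h1 : U + y a ^ 2 = U * (1 + y a ^ 2 / U) := by field_simp
      rw [h1, Real.mul_rpow hU0.le (by positivity)]
      have h2 : (1 + y a ^ 2 / U) ^ (p / 2) ≤ 1 + p / 2 * (y a ^ 2 / U) :=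
        rpow_one_add_le_one_add_mul_self (by linarith [show 0 ≤ y a ^ 2 / U by positivity])
          (by linarith) (by linarith)
      have h3 : U ^ (p / 2) ≤ U := by
        conv_rhs => rw [← Real.rpow_one U]
        exact Real.rpow_le_rpow_of_exponent_le hU1 (by linarith)
      have h4 : 0 ≤ y a ^ 2 / U := by positivity
      have h5 : U ^ (p / 2) * (y a ^ 2 / U) ≤ y a ^ 2 := by
        calc _ ≤ U * (y a ^ 2 / U) := mul_le_mul_of_nonneg_right h3 h4
          _ = y a ^ 2 := by field_simp
      calc _ ≤ U ^ (p / 2) * (1 + p / 2 * (y a ^ 2 / U)) :=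
            mul_le_mul_of_nonneg_left h2 (by positivity)
        _ = U ^ (p / 2) + p / 2 * (U ^ (p / 2) * (y a ^ 2 / U)) := by ring
        _ ≤ U ^ (p / 2) + 1 * y a ^ 2 := by
            gcongr
            linarith
        _ = _ := by ring
    · have h1 : |y a| ^ p = (y a ^ 2) ^ (p / 2) := by
        rw [← sq_abs, ← Real.rpow_natCast, ← Real.rpow_mul (abs_nonneg _)]
        congr 1
        push_cast
        ring
      rw [h1]
      exact Real.rpow_add_le_add_rpow hU0.le (sq_nonneg _) (by linarith) (by linarith)

theorem sum_sq_rpow_le {ι : Type*} {p : ℝ} (hp : 0 ≤ p) (hp2 : p ≤ 2) (s : Finset ι)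
    (y : ι → ℝ) : (∑ i ∈ s, y i ^ 2) ^ (p / 2) ≤ 1 + ∑ i ∈ s, trunc p (y i) :=
  (Real.rpow_le_rpow (Finset.sum_nonneg fun i _ => sq_nonneg _) (by linarith)
    (by linarith)).trans (one_add_sum_sq_rpow_le hp hp2 s y)

theorem sum_trunc_div_le {ι : Type*} [DecidableEq ι] (s : Finset ι) (y : ι → ℝ) :
    ∑ i ∈ s, trunc 1 (y i) / √(1 + ∑ j ∈ s.erase i, min |y j| 1 ^ 2) ≤ √(∑ i ∈ s, y i ^ 2) := by
  set D := ∑ j ∈ s, min |y j| 1 ^ 2 with hD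
  have hD0 : 0 ≤ D := Finset.sum_nonneg fun i _ => sq_nonneg _
  have h1 : ∀ i ∈ s, trunc 1 (y i) / √(1 + ∑ j ∈ s.erase i, min |y j| 1 ^ 2) ≤
      trunc 1 (y i) / √D := fun i hi => by
    rcases hD0.eq_or_lt with h | h
    · have : min |y i| 1 ^ 2 = 0 := by
        have := (Finset.sum_eq_zero_iff_of_nonneg (fun i _ => sq_nonneg (min |y i| 1))).1 h.symm
        exact this i hi
      rw [trunc_one_eq, pow_eq_zero_iff two_ne_zero |>.1 this]
      simp
    · refine div_le_div_of_nonneg_left (trunc_nonneg _ _) (Real.sqrt_pos.2 h)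
        (Real.sqrt_le_sqrt ?_)
      rw [hD, ← Finset.add_sum_erase s _ hi]
      gcongr
      exact pow_le_one₀ (le_min (abs_nonneg _) zero_le_one) (min_le_right _ _)
  refine (Finset.sum_le_sum h1).trans ?_
  rw [← Finset.sum_div]
  refine div_le_of_le_mul₀ (Real.sqrt_nonneg _) (Real.sqrt_nonneg _) ?_
  have h2 := Real.sum_mul_le_sqrt_mul_sqrt s (fun i => |y i|) (fun i => min |y i| 1)
  simpa [trunc_one_eq] using h2

theorem tangent_le_inv_sqrt {c y : ℝ} (hc : 0 < c) (hy : 0 < y) :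
    (3 * c ^ 2 - y) / (2 * c ^ 3) ≤ (√y)⁻¹ := by
  have hu := Real.sqrt_pos.2 hy
  set u := √y with hu'
  have : y = u ^ 2 := (Real.sq_sqrt hy.le).symm
  rw [this, div_le_iff₀ (by positivity), inv_mul_eq_div, le_div_iff₀ hu]
  nlinarith [mul_nonneg (sq_nonneg (u - c)) (show 0 ≤ u + 2 * c by positivity)]

theorem sqrt_sum_sq_le_sum_abs {ι : Type*} (s : Finset ι) (y : ι → ℝ) :
    √(∑ i ∈ s, y i ^ 2) ≤ ∑ i ∈ s, |y i| := by
  rw [Real.sqrt_le_left (Finset.sum_nonneg fun i _ => abs_nonneg _)]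
  calc ∑ i ∈ s, y i ^ 2 = ∑ i ∈ s, |y i| ^ 2 := by simp
    _ ≤ _ := Finset.sum_sq_le_sq_sum_of_nonneg fun i _ => abs_nonneg _

theorem integrable_sqrt_sum_sq {Ω : Type*} [MeasurableSpace Ω] {μ : Measure Ω} {ι : Type*}
    [Fintype ι] {Y : ι → Ω → ℝ} (hm : ∀ i, Measurable (Y i)) (hi : ∀ i, Integrable (Y i) μ) :
    Integrable (fun ω => √(∑ i, Y i ω ^ 2)) μ := by
  refine (integrable_finsetSum Finset.univ fun i _ => (hi i).abs).mono
    (Measurable.aestronglyMeasurable (by fun_prop)) (.of_forall fun ω => ?_)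
  rw [Real.norm_of_nonneg (Real.sqrt_nonneg _), Real.norm_of_nonneg
    (Finset.sum_nonneg fun i _ => abs_nonneg _)]
  exact sqrt_sum_sq_le_sum_abs _ _

theorem le_integral_sqrt_sum_sq {Ω : Type*} [MeasurableSpace Ω] {μ : Measure Ω}
    [IsProbabilityMeasure μ] {ι : Type*} [Fintype ι] {Y : ι → Ω → ℝ}
    (hm : ∀ i, Measurable (Y i)) (hi : ∀ i, Integrable (Y i) μ) (hind : iIndepFun Y μ)
    (h : 1 / 2 ≤ ∑ i, ∫ ω, trunc 1 (Y i ω) ∂μ) :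
    2 / 5 ≤ ∫ ω, √(∑ i, Y i ω ^ 2) ∂μ := by
  classical
  set m := ∑ i, ∫ ω, trunc 1 (Y i ω) ∂μ with hmdef
  have hm0 : 0 < 1 + m := by linarith
  set c := √(1 + m) with hc
  have hc0 : 0 < c := Real.sqrt_pos.2 hm0
  have hc2 : c ^ 2 = 1 + m := Real.sq_sqrt hm0.le
  have hZm : ∀ i, Measurable fun ω => trunc 1 (Y i ω) := fun i => (measurable_trunc 1).comp (hm i)
  have hZi : ∀ i, Integrable (fun ω => trunc 1 (Y i ω)) μ := fun i =>
    (hi i).mono (hZm i).aestronglyMeasurable (.of_forall fun ω => by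
      rw [Real.norm_of_nonneg (trunc_nonneg _ _)]
      exact trunc_one_le_abs _)
  have hDm : ∀ i, Measurable fun ω => min |Y i ω| 1 ^ 2 := fun i => by
    have := hm i
    fun_prop
  have hDle : ∀ i ω, min |Y i ω| 1 ^ 2 ≤ trunc 1 (Y i ω) := fun i ω => by
    rw [trunc_one_eq, sq]
    exact mul_le_mul_of_nonneg_right (min_le_left _ _) (le_min (abs_nonneg _) zero_le_one)
  have hDi : ∀ i, Integrable (fun ω => min |Y i ω| 1 ^ 2) μ := fun i =>
    (hZi i).mono (hDm i).aestronglyMeasurable (.of_forall fun ω => by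
      rw [Real.norm_of_nonneg (sq_nonneg _), Real.norm_of_nonneg (trunc_nonneg _ _)]
      exact hDle i ω)
  have hφm : ∀ i, Measurable fun ω => (√(1 + ∑ j ∈ Finset.univ.erase i, min |Y j ω| 1 ^ 2))⁻¹ :=
    fun i => by fun_prop
  have hge1 : ∀ i ω, 1 ≤ 1 + ∑ j ∈ Finset.univ.erase i, min |Y j ω| 1 ^ 2 := fun i ω =>
    le_add_of_nonneg_right (Finset.sum_nonneg fun i _ => sq_nonneg _)
  have hφle : ∀ i ω, (√(1 + ∑ j ∈ Finset.univ.erase i, min |Y j ω| 1 ^ 2))⁻¹ ≤ 1 := fun i ω =>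
    inv_le_one_of_one_le₀ (Real.one_le_sqrt.2 (hge1 i ω))
  have hφi : ∀ i, Integrable
      (fun ω => (√(1 + ∑ j ∈ Finset.univ.erase i, min |Y j ω| 1 ^ 2))⁻¹) μ := fun i =>
    Integrable.of_bound (hφm i).aestronglyMeasurable 1 (.of_forall fun ω => by
      rw [Real.norm_of_nonneg (by positivity)]
      exact hφle i ω)
  have hφ : ∀ i, c⁻¹ ≤ ∫ ω, (√(1 + ∑ j ∈ Finset.univ.erase i, min |Y j ω| 1 ^ 2))⁻¹ ∂μ :=
    fun i => by
    have hsum : Integrable (fun ω => ∑ j ∈ Finset.univ.erase i, min |Y j ω| 1 ^ 2) μ :=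
      integrable_finsetSum _ fun j _ => hDi j
    have h1 : ∫ ω, (3 * c ^ 2 - (1 + ∑ j ∈ Finset.univ.erase i, min |Y j ω| 1 ^ 2)) /
        (2 * c ^ 3) ∂μ ≤ ∫ ω, (√(1 + ∑ j ∈ Finset.univ.erase i, min |Y j ω| 1 ^ 2))⁻¹ ∂μ := by
      refine integral_mono ?_ (hφi i) fun ω => tangent_le_inv_sqrt hc0
        (zero_lt_one.trans_le (hge1 i ω))
      exact ((integrable_const _).sub ((integrable_const _).add hsum)).div_const _
    refine le_trans ?_ h1
    have hsum1 : Integrable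
        (fun ω => 1 + ∑ j ∈ Finset.univ.erase i, min |Y j ω| 1 ^ 2) μ :=
      (integrable_const _).add hsum
    rw [integral_div, integral_sub (integrable_const _) hsum1,
      integral_add (integrable_const _) hsum, integral_finsetSum _ fun j _ => hDi j]
    have h2 : ∑ j ∈ Finset.univ.erase i, ∫ ω, min |Y j ω| 1 ^ 2 ∂μ ≤ m :=
      calc _ ≤ ∑ j ∈ Finset.univ.erase i, ∫ ω, trunc 1 (Y j ω) ∂μ :=
            Finset.sum_le_sum fun j _ => integral_mono (hDi j) (hZi j) (hDle j)
        _ ≤ m := Finset.sum_le_sum_of_subset_of_nonneg (Finset.erase_subset _ _)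
            fun j _ _ => integral_nonneg fun ω => trunc_nonneg _ _
    simp only [integral_const, probReal_univ, one_smul]
    rw [inv_eq_one_div, div_le_div_iff₀ hc0 (by positivity)]
    have : c ^ 2 * (2 * c) ≤ (3 * c ^ 2 - (1 + ∑ j ∈ Finset.univ.erase i,
        ∫ ω, min |Y j ω| 1 ^ 2 ∂μ)) * c := by
      rw [mul_comm 2 c, ← mul_assoc, mul_comm (c ^ 2 * c), ← mul_assoc]
      exact mul_le_mul_of_nonneg_right (by linarith) hc0.le
    linarith [show c ^ 2 * (2 * c) = 1 * (2 * c ^ 3) by ring]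
  have hindep : ∀ i, IndepFun (fun ω => trunc 1 (Y i ω))
      (fun ω => (√(1 + ∑ j ∈ Finset.univ.erase i, min |Y j ω| 1 ^ 2))⁻¹) μ := fun i => by
    have h1 := hind.indepFun_finset {i} (Finset.univ.erase i) (by simp) hm
    have h2 := h1.comp (φ := fun v : ({i} : Finset ι) → ℝ => trunc 1 (v ⟨i, by simp⟩))
      (ψ := fun (v : ↥(Finset.univ.erase i) → ℝ) => (√(1 + ∑ j, min |v j| 1 ^ 2))⁻¹)
      ((measurable_trunc 1).comp (measurable_pi_apply _)) (by fun_prop)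
    refine h2.congr (.of_forall fun ω => rfl) (.of_forall fun ω => ?_)
    simp only [Function.comp]
    rw [← Finset.sum_coe_sort (Finset.univ.erase i)]
  have hSi := integrable_sqrt_sum_sq hm hi
  have hprod : ∀ i, Integrable (fun ω => trunc 1 (Y i ω) *
      (√(1 + ∑ j ∈ Finset.univ.erase i, min |Y j ω| 1 ^ 2))⁻¹) μ := fun i =>
    (hindep i).integrable_mul (hZi i) (hφi i)
  have key : m * c⁻¹ ≤ ∫ ω, √(∑ i, Y i ω ^ 2) ∂μ := by
    calc m * c⁻¹ = ∑ i, (∫ ω, trunc 1 (Y i ω) ∂μ) * c⁻¹ := by rw [hmdef, Finset.sum_mul]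
      _ ≤ ∑ i, (∫ ω, trunc 1 (Y i ω) ∂μ) *
          ∫ ω, (√(1 + ∑ j ∈ Finset.univ.erase i, min |Y j ω| 1 ^ 2))⁻¹ ∂μ :=
        Finset.sum_le_sum fun i _ => mul_le_mul_of_nonneg_left (hφ i)
          (integral_nonneg fun ω => trunc_nonneg _ _)
      _ = ∫ ω, ∑ i, trunc 1 (Y i ω) *
          (√(1 + ∑ j ∈ Finset.univ.erase i, min |Y j ω| 1 ^ 2))⁻¹ ∂μ := by
        rw [integral_finsetSum _ fun i _ => hprod i]
        exact Finset.sum_congr rfl fun i _ => ((hindep i).integral_fun_mul_eq_mul_integral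
          (hZm i).aestronglyMeasurable (hφm i).aestronglyMeasurable).symm
      _ ≤ _ := integral_mono (integrable_finsetSum _ fun i _ => hprod i) hSi fun ω =>
        sum_trunc_div_le Finset.univ fun i => Y i ω
  refine le_trans ?_ key
  rw [← div_eq_mul_inv, le_div_iff₀ hc0]
  have : c ≤ 5 / 2 * m := Real.sqrt_le_iff.2 ⟨by linarith, by nlinarith⟩
  linarith

theorem rademacher_ae {Ω : Type*} [MeasurableSpace Ω] {μ : Measure Ω} {r : Ω → ℝ}
    (h : HasLaw r rademacherLaw μ) : ∀ᵐ ω ∂μ, r ω ^ 2 = 1 := by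
  refine (h.ae_iff (p := fun x => x ^ 2 = 1) ?_).2 ?_
  · exact measurableSet_setOfPred.1
      (measurableSet_eq_fun (f := fun x : ℝ => x ^ 2) (by fun_prop) measurable_const)
  · rw [rademacherLaw, ae_add_measure_iff]
    constructor <;> refine Measure.ae_smul_measure ?_ _ <;> simp [ae_dirac_eq]

theorem integral_rademacher {Ω : Type*} [MeasurableSpace Ω] {μ : Measure Ω} {r : Ω → ℝ}
    (h : HasLaw r rademacherLaw μ) : ∫ ω, r ω ∂μ = 0 := by
  rw [h.integral_eq, rademacherLaw, integral_add_measure, integral_smul_measure,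
    integral_smul_measure]
  · simp
  · exact (integrable_dirac (by simp)).smul_measure (by simp)
  · exact (integrable_dirac (by simp)).smul_measure (by simp)

theorem rademacher_sum_moments {Ω : Type*} [MeasurableSpace Ω] {μ : Measure Ω}
    [IsProbabilityMeasure μ] {ι : Type*} {r : ι → Ω → ℝ} (hm : ∀ i, Measurable (r i))
    (hlaw : ∀ i, HasLaw (r i) rademacherLaw μ) (hind : iIndepFun r μ) (c : ι → ℝ)
    (s : Finset ι) :
    (∃ B : ℝ, ∀ᵐ ω ∂μ, |∑ i ∈ s, c i * r i ω| ≤ B) ∧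
      ∫ ω, (∑ i ∈ s, c i * r i ω) ^ 2 ∂μ = ∑ i ∈ s, c i ^ 2 ∧
      ∫ ω, (∑ i ∈ s, c i * r i ω) ^ 4 ∂μ ≤ 3 * (∑ i ∈ s, c i ^ 2) ^ 2 := by
  classical
  induction s using Finset.induction_on with
  | empty => exact ⟨⟨0, by simp⟩, by simp, by simp⟩
  | insert a s ha ih =>
    obtain ⟨⟨B, hB⟩, h2, h4⟩ := ih
    have hra := rademacher_ae (hlaw a)
    set T : Ω → ℝ := fun ω => ∑ i ∈ s, c i * r i ω with hT
    have hTm : Measurable T := by fun_prop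
    have hTk : ∀ k : ℕ, Integrable (fun ω => T ω ^ k) μ := fun k =>
      Integrable.of_bound (hTm.pow_const k).aestronglyMeasurable (B ^ k) (by
        filter_upwards [hB] with ω hω
        rw [norm_pow]
        exact pow_le_pow_left₀ (norm_nonneg _) hω k)
    have hri : Integrable (r a) μ := Integrable.of_bound (hm a).aestronglyMeasurable 1 (by
      filter_upwards [hra] with ω hω
      rw [Real.norm_eq_abs, ← sq_le_one_iff_abs_le_one, hω])
    have hindk : ∀ k : ℕ, IndepFun (fun ω => T ω ^ k) (r a) μ := fun k => by
      have h1 := hind.indepFun_finset s {a} (by simpa using ha) hm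
      exact h1.comp (φ := fun (v : s → ℝ) => (∑ i : s, c i * v i) ^ k)
        (ψ := fun (v : ↥({a} : Finset ι) → ℝ) => v ⟨a, by simp⟩) (by fun_prop) (by fun_prop)
        |>.congr (.of_forall fun ω => by
          simp only [Function.comp, hT]
          rw [← Finset.sum_coe_sort s]) (.of_forall fun ω => rfl)
    have hTr : ∀ k : ℕ, Integrable (fun ω => T ω ^ k * r a ω) μ := fun k =>
      (hindk k).integrable_mul (hTk k) hri
    have hTr0 : ∀ k : ℕ, ∫ ω, T ω ^ k * r a ω ∂μ = 0 := fun k => by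
      rw [(hindk k).integral_fun_mul_eq_mul_integral (hTk k).aestronglyMeasurable
        hri.aestronglyMeasurable, integral_rademacher (hlaw a), mul_zero]
    simp only [Finset.sum_insert ha]
    have hw : 0 ≤ ∑ i ∈ s, c i ^ 2 := Finset.sum_nonneg fun i _ => sq_nonneg _
    refine ⟨⟨|c a| + B, ?_⟩, ?_, ?_⟩
    · filter_upwards [hB, hra] with ω hω hr
      refine (abs_add_le _ _).trans (add_le_add ?_ hω)
      rw [abs_mul, show |r a ω| = 1 by
        rwa [← abs_one, ← sq_eq_sq_iff_abs_eq_abs, one_pow], mul_one]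
    · have e : (fun ω => (c a * r a ω + T ω) ^ 2) =ᵐ[μ]
          fun ω => T ω ^ 2 + (2 * c a) * (T ω ^ 1 * r a ω) + c a ^ 2 := by
        filter_upwards [hra] with ω hr
        linear_combination c a ^ 2 * hr
      have i1 : Integrable (fun ω => T ω ^ 2 + (2 * c a) * (T ω ^ 1 * r a ω)) μ :=
        (hTk 2).add ((hTr 1).const_mul _)
      rw [integral_congr_ae e, integral_add i1
        (integrable_const _), integral_add (hTk 2) ((hTr 1).const_mul _), integral_const_mul,
        hTr0, h2]
      simp
      ring
    · have e : (fun ω => (c a * r a ω + T ω) ^ 4) =ᵐ[μ]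
          fun ω => T ω ^ 4 + (4 * c a) * (T ω ^ 3 * r a ω) + (6 * c a ^ 2) * T ω ^ 2 +
            (4 * c a ^ 3) * (T ω ^ 1 * r a ω) + c a ^ 4 := by
        filter_upwards [hra] with ω hr
        linear_combination (6 * c a ^ 2 * T ω ^ 2 + 4 * c a ^ 3 * T ω * r a ω +
          c a ^ 4 * (r a ω ^ 2 + 1)) * hr
      have i1 : Integrable (fun ω => T ω ^ 4 + (4 * c a) * (T ω ^ 3 * r a ω)) μ :=
        (hTk 4).add ((hTr 3).const_mul (4 * c a))
      have i2 : Integrable (fun ω => T ω ^ 4 + (4 * c a) * (T ω ^ 3 * r a ω) +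
          (6 * c a ^ 2) * T ω ^ 2) μ :=
        i1.add ((hTk 2).const_mul (6 * c a ^ 2))
      have i3 : Integrable (fun ω => T ω ^ 4 + (4 * c a) * (T ω ^ 3 * r a ω) +
          (6 * c a ^ 2) * T ω ^ 2 + (4 * c a ^ 3) * (T ω ^ 1 * r a ω)) μ :=
        i2.add ((hTr 1).const_mul (4 * c a ^ 3))
      rw [integral_congr_ae e, integral_add i3 (integrable_const _),
        integral_add i2 ((hTr 1).const_mul _), integral_add i1 ((hTk 2).const_mul _),
        integral_add (hTk 4) ((hTr 3).const_mul _), integral_const_mul, integral_const_mul,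
        integral_const_mul, hTr0, hTr0, h2]
      simp only [integral_const, probReal_univ, one_smul]
      nlinarith [sq_nonneg (c a ^ 2)]

theorem khintchine {Ω : Type*} [MeasurableSpace Ω] {μ : Measure Ω}
    [IsProbabilityMeasure μ] {ι : Type*} [Fintype ι] {r : ι → Ω → ℝ} (hm : ∀ i, Measurable (r i))
    (hlaw : ∀ i, HasLaw (r i) rademacherLaw μ) (hind : iIndepFun r μ) (c : ι → ℝ) :
    Integrable (fun ω => ∑ i, c i * r i ω) μ ∧
      1 / 2 * √(∑ i, c i ^ 2) ≤ ∫ ω, |∑ i, c i * r i ω| ∂μ ∧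
      ∫ ω, |∑ i, c i * r i ω| ∂μ ≤ √(∑ i, c i ^ 2) := by
  obtain ⟨⟨B, hB⟩, h2, h4⟩ := rademacher_sum_moments hm hlaw hind c Finset.univ
  set T : Ω → ℝ := fun ω => ∑ i, c i * r i ω with hT
  have hTm : Measurable T := by fun_prop
  have hTk : ∀ k : ℕ, Integrable (fun ω => T ω ^ k) μ := fun k =>
    Integrable.of_bound (hTm.pow_const k).aestronglyMeasurable (B ^ k) (by
      filter_upwards [hB] with ω hω
      rw [norm_pow]
      exact pow_le_pow_left₀ (norm_nonneg _) hω k)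
  have hT1 : Integrable T μ := by simpa using hTk 1
  refine ⟨hT1, ?_⟩
  have hw0 : 0 ≤ ∑ i, c i ^ 2 := Finset.sum_nonneg fun i _ => sq_nonneg _
  rcases hw0.eq_or_lt with h0 | h0
  · have hc : ∀ i, c i = 0 := fun i => by
      have := (Finset.sum_eq_zero_iff_of_nonneg (fun i _ => sq_nonneg (c i))).1 h0.symm i
        (Finset.mem_univ i)
      exact pow_eq_zero_iff two_ne_zero |>.1 this
    simp [hc]
  set w := √(∑ i, c i ^ 2) with hw
  have hwpos : 0 < w := Real.sqrt_pos.2 h0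
  have hw2 : ∑ i, c i ^ 2 = w ^ 2 := (Real.sq_sqrt hw0).symm
  rw [hw2] at h2 h4
  constructor
  · have h1 : ∫ ω, (w⁻¹ * T ω ^ 2 - (6 * w ^ 3)⁻¹ * T ω ^ 4) ∂μ ≤ ∫ ω, |T ω| ∂μ := by
      refine integral_mono (((hTk 2).const_mul _).sub ((hTk 4).const_mul _)) hT1.abs fun ω => ?_
      have ht : 0 ≤ |T ω| := abs_nonneg _
      simp only
      rw [← sq_abs, show T ω ^ 4 = |T ω| ^ 4 from (Even.pow_abs (by decide) _).symm]
      set t := |T ω|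
      have e : w⁻¹ * t ^ 2 - (6 * w ^ 3)⁻¹ * t ^ 4 =
          (6 * w ^ 2 * t ^ 2 - t ^ 4) / (6 * w ^ 3) := by
        field_simp
      rw [e, div_le_iff₀ (by positivity)]
      have : 0 ≤ 6 * w ^ 3 - 6 * w ^ 2 * t + t ^ 3 := by
        nlinarith [mul_nonneg (show 0 ≤ t + 2 * (7 / 5 * w) by positivity)
          (sq_nonneg (t - 7 / 5 * w)), mul_nonneg (sq_nonneg w) ht, pow_pos hwpos 3]
      nlinarith [mul_nonneg ht this]
    refine le_trans ?_ h1
    rw [integral_sub ((hTk 2).const_mul _) ((hTk 4).const_mul _), integral_const_mul,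
      integral_const_mul, h2]
    have h5 : (6 * w ^ 3)⁻¹ * ∫ ω, T ω ^ 4 ∂μ ≤ (6 * w ^ 3)⁻¹ * (3 * (w ^ 2) ^ 2) :=
      mul_le_mul_of_nonneg_left h4 (by positivity)
    have e1 : (6 * w ^ 3)⁻¹ * (3 * (w ^ 2) ^ 2) = 1 / 2 * w := by
      field_simp
      norm_num
    have e2 : w⁻¹ * w ^ 2 = w := by field_simp
    linarith
  · have h1 : ∫ ω, |T ω| ∂μ ≤ ∫ ω, ((2 * w)⁻¹ * T ω ^ 2 + w / 2) ∂μ := by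
      refine integral_mono hT1.abs (((hTk 2).const_mul _).add (integrable_const _)) fun ω => ?_
      simp only
      rw [← sq_abs]
      have e : (2 * w)⁻¹ * |T ω| ^ 2 + w / 2 = (|T ω| ^ 2 + w ^ 2) / (2 * w) := by
        field_simp
      rw [e, le_div_iff₀ (by positivity)]
      nlinarith [sq_nonneg (|T ω| - w)]
    rw [integral_add ((hTk 2).const_mul _) (integrable_const _), integral_const_mul, h2] at h1
    simp only [integral_const, probReal_univ, one_smul] at h1
    have e : (2 * w)⁻¹ * w ^ 2 + w / 2 = w := by
      field_simp
      norm_num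
    linarith

theorem lintegral_Ioi_of_hasDerivAt {g g' : ℝ → ℝ} {a l : ℝ}
    (hcont : ContinuousWithinAt g (Ici a) a) (hderiv : ∀ x ∈ Ioi a, HasDerivAt g (g' x) x)
    (hpos : ∀ x ∈ Ioi a, 0 ≤ g' x) (hg : Tendsto g atTop (𝓝 l)) :
    ∫⁻ x in Ioi a, ENNReal.ofReal (g' x) = ENNReal.ofReal (l - g a) := by
  rw [← integral_Ioi_of_hasDerivAt_of_nonneg hcont hderiv hpos hg,
    ofReal_integral_eq_lintegral_ofReal
      (integrableOn_Ioi_deriv_of_nonneg hcont hderiv hpos hg)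
      ((ae_restrict_iff' measurableSet_Ioi).2 (.of_forall hpos))]

theorem sub_nonneg_of_hasDerivAt {g g' : ℝ → ℝ} {a l : ℝ}
    (hcont : ContinuousWithinAt g (Ici a) a) (hderiv : ∀ x ∈ Ioi a, HasDerivAt g (g' x) x)
    (hpos : ∀ x ∈ Ioi a, 0 ≤ g' x) (hg : Tendsto g atTop (𝓝 l)) : 0 ≤ l - g a := by
  rw [← integral_Ioi_of_hasDerivAt_of_nonneg hcont hderiv hpos hg]
  exact setIntegral_nonneg measurableSet_Ioi hpos

theorem lintegral_Ioc_of_hasDerivAt {g g' : ℝ → ℝ} {a b : ℝ} (hab : a ≤ b)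
    (hderiv : ∀ x ∈ Icc a b, HasDerivAt g (g' x) x) (hcont : ContinuousOn g' (Icc a b))
    (hpos : ∀ x ∈ Icc a b, 0 ≤ g' x) :
    ∫⁻ x in Ioc a b, ENNReal.ofReal (g' x) = ENNReal.ofReal (g b - g a) := by
  have hint : IntervalIntegrable g' volume a b :=
    ContinuousOn.intervalIntegrable (by rwa [uIcc_of_le hab])
  rw [← intervalIntegral.integral_eq_sub_of_hasDerivAt (by rwa [uIcc_of_le hab]) hint,
    intervalIntegral.integral_of_le hab, ofReal_integral_eq_lintegral_ofReal
      ((intervalIntegrable_iff_integrableOn_Ioc_of_le hab).1 hint)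
      ((ae_restrict_iff' measurableSet_Ioc).2 (.of_forall fun x hx => hpos x ⟨hx.1.le, hx.2⟩))]

namespace OrliczFunction.Admissible

variable {M : OrliczFunction} {q C : ℝ}

theorem hasDerivAt (h : M.Admissible 2 q C) {x : ℝ} (hx : 0 < x) :
    HasDerivAt M (deriv M x) x :=
  ((h.contDiffOn.differentiableOn (by norm_num)).differentiableAt (Ioi_mem_nhds hx)).hasDerivAt

theorem contDiffOn_deriv (h : M.Admissible 2 q C) : ContDiffOn ℝ 2 (deriv M) (Ioi 0) :=
  h.contDiffOn.deriv_of_isOpen isOpen_Ioi (by norm_num)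

theorem contDiffOn_deriv_two (h : M.Admissible 2 q C) :
    ContDiffOn ℝ 1 (iteratedDeriv 2 M) (Ioi 0) := by
  rw [iteratedDeriv_succ, iteratedDeriv_one]
  exact h.contDiffOn_deriv.deriv_of_isOpen isOpen_Ioi (by norm_num)

theorem continuousOn_deriv_three (h : M.Admissible 2 q C) :
    ContinuousOn (iteratedDeriv 3 M) (Ioi 0) := by
  rw [iteratedDeriv_succ]
  exact (h.contDiffOn_deriv_two.deriv_of_isOpen (m := 0) isOpen_Ioi (by norm_num)).continuousOn

theorem hasDerivAt_deriv (h : M.Admissible 2 q C) {x : ℝ} (hx : 0 < x) :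
    HasDerivAt (deriv M) (iteratedDeriv 2 M x) x := by
  rw [iteratedDeriv_succ, iteratedDeriv_one]
  exact ((h.contDiffOn_deriv.differentiableOn (by norm_num)).differentiableAt
    (Ioi_mem_nhds hx)).hasDerivAt

theorem hasDerivAt_deriv_two (h : M.Admissible 2 q C) {x : ℝ} (hx : 0 < x) :
    HasDerivAt (iteratedDeriv 2 M) (iteratedDeriv 3 M x) x := by
  rw [iteratedDeriv_succ (n := 2)]
  exact ((h.contDiffOn_deriv_two.differentiableOn (by norm_num)).differentiableAt
    (Ioi_mem_nhds hx)).hasDerivAt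

theorem _root_.OrliczEmbedding.OrliczFunction.density_two (M : OrliczFunction) (s : ℝ) :
    M.density 2 s = -(1 / 2 * (s ^ 4)⁻¹ * iteratedDeriv 3 M s⁻¹) := by
  rw [density]
  norm_num

theorem deriv_three_nonpos (h : M.Admissible 2 q C) {x : ℝ} (hx : 0 < x) :
    iteratedDeriv 3 M x ≤ 0 := by
  have h1 := h.density_nonneg x⁻¹ (inv_pos.2 hx)
  rw [density_two, inv_inv] at h1
  have h2 : 0 < 1 / 2 * ((x⁻¹ ^ 4)⁻¹ : ℝ) := by positivity
  by_contra! h3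
  linarith [mul_pos h2 h3]

theorem antitoneOn_deriv_two (h : M.Admissible 2 q C) :
    AntitoneOn (iteratedDeriv 2 M) (Ioi 0) := by
  refine antitoneOn_of_deriv_nonpos (convex_Ioi 0) h.contDiffOn_deriv_two.continuousOn ?_ ?_
  · rw [interior_Ioi]
    exact h.contDiffOn_deriv_two.differentiableOn (by norm_num)
  · rw [interior_Ioi]
    intro x hx
    rw [(h.hasDerivAt_deriv_two hx).deriv]
    exact h.deriv_three_nonpos hx

theorem _root_.OrliczEmbedding.OrliczFunction.deriv_eq_of_affine (M : OrliczFunction) {x₀ a b : ℝ}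
    (hlin : ∀ x, x₀ ≤ x → M x = a * x + b) {x : ℝ} (hx : x₀ < x) :
    deriv M x = a ∧ iteratedDeriv 2 M x = 0 ∧ iteratedDeriv 3 M x = 0 := by
  have h1 : ∀ y, x₀ < y → deriv M y = a := fun y hy => by
    have e : (M : ℝ → ℝ) =ᶠ[𝓝 y] fun x => a * x + b := by
      filter_upwards [Ioi_mem_nhds hy] with z hz using hlin z (le_of_lt hz)
    rw [e.deriv_eq]
    simp
  have h2 : ∀ y, x₀ < y → iteratedDeriv 2 M y = 0 := fun y hy => by
    have e : deriv M =ᶠ[𝓝 y] fun _ => a := by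
      filter_upwards [Ioi_mem_nhds hy] with z hz using h1 z hz
    rw [iteratedDeriv_succ, iteratedDeriv_one, e.deriv_eq, deriv_const]
  have h3 : iteratedDeriv 3 M x = 0 := by
    have e : iteratedDeriv 2 M =ᶠ[𝓝 x] fun _ => (0 : ℝ) := by
      filter_upwards [Ioi_mem_nhds hx] with z hz using h2 z hz
    rw [iteratedDeriv_succ, e.deriv_eq, deriv_const]
  exact ⟨h1 x hx, h2 x hx, h3⟩

theorem deriv_two_nonneg (h : M.Admissible 2 q C) {x : ℝ} (hx : 0 < x) :
    0 ≤ iteratedDeriv 2 M x := by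
  obtain ⟨x₀, hx₀, a, b, hlin⟩ := h.linear
  have h1 : 0 < max x x₀ + 1 := by positivity
  rw [← (M.deriv_eq_of_affine hlin (x := max x x₀ + 1)
    (by linarith [le_max_right x x₀])).2.1]
  exact h.antitoneOn_deriv_two hx h1 (by linarith [le_max_left x x₀])

theorem deriv_nonneg (h : M.Admissible 2 q C) {x : ℝ} (hx : 0 < x) : 0 ≤ deriv M x := by
  have h1 := M.convexOn.slope_le_of_hasDerivAt (x := 0) (y := x) self_mem_Ici hx.le hx
    (h.hasDerivAt hx)
  refine le_trans ?_ h1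
  rw [slope_def_field, M.map_zero]
  have := M.nonneg hx.le
  simp only [sub_zero]
  positivity

theorem tendsto_zero (h : M.Admissible 2 q C) : Tendsto M (𝓝[>] 0) (𝓝 0) := by
  have h1 := h.deriv_zero.continuousWithinAt.tendsto
  rw [M.map_zero] at h1
  exact h1.mono_left (nhdsWithin_mono _ Ioi_subset_Ici_self)

theorem tendsto_deriv_zero (h : M.Admissible 2 q C) : Tendsto (deriv M) (𝓝[>] 0) (𝓝 0) := by
  have h1 : Tendsto (slope M 0) (𝓝[>] 0) (𝓝 0) :=
    (hasDerivWithinAt_iff_tendsto_slope' (by simp)).1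
      (h.deriv_zero.mono Ioi_subset_Ici_self)
  have h2 : Tendsto (fun x : ℝ => 2 * x) (𝓝[>] 0) (𝓝[>] 0) := by
    refine tendsto_nhdsWithin_iff.2 ⟨?_, ?_⟩
    · have : Tendsto (fun x : ℝ => 2 * x) (𝓝 0) (𝓝 (2 * 0)) := by
        apply Continuous.tendsto
        fun_prop
      rw [mul_zero] at this
      exact this.mono_left nhdsWithin_le_nhds
    · filter_upwards [self_mem_nhdsWithin] with x hx
      exact mul_pos two_pos (show (0 : ℝ) < x from hx)
  have h3 : Tendsto (fun x => 2 * slope M 0 (2 * x)) (𝓝[>] 0) (𝓝 0) := by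
    simpa using (h1.comp h2).const_mul 2
  refine tendsto_of_tendsto_of_tendsto_of_le_of_le' tendsto_const_nhds h3 ?_ ?_
  · filter_upwards [self_mem_nhdsWithin] with x hx using h.deriv_nonneg hx
  · filter_upwards [self_mem_nhdsWithin] with x hx
    have hx : 0 < x := hx
    have h4 := M.convexOn.le_slope_of_hasDerivAt (x := x) (y := 2 * x) hx.le
      (show (0 : ℝ) ≤ 2 * x by positivity) (by linarith) (h.hasDerivAt hx)
    refine h4.trans ?_
    rw [slope_def_field, slope_def_field, M.map_zero, sub_zero, sub_zero,
      show 2 * x - x = x by ring, show 2 * (M (2 * x) / (2 * x)) = M (2 * x) / x by field_simp]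
    gcongr
    linarith [M.nonneg hx.le]

theorem tendsto_mul_deriv_two_zero (h : M.Admissible 2 q C) :
    Tendsto (fun x => x * iteratedDeriv 2 M x) (𝓝[>] 0) (𝓝 0) := by
  have h3 : Tendsto (fun x => 2 * deriv M x) (𝓝[>] 0) (𝓝 0) := by
    simpa using h.tendsto_deriv_zero.const_mul 2
  refine tendsto_of_tendsto_of_tendsto_of_le_of_le' tendsto_const_nhds h3 ?_ ?_
  · filter_upwards [self_mem_nhdsWithin] with x hx using
      mul_nonneg (le_of_lt hx) (h.deriv_two_nonneg hx)
  · filter_upwards [self_mem_nhdsWithin] with x hx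
    have hx : 0 < x := hx
    have hsub : Icc (x / 2) x ⊆ Ioi 0 := fun y hy => lt_of_lt_of_le (by positivity) hy.1
    have h1 := (convex_Icc (x / 2) x).mul_sub_le_image_sub_of_le_deriv (f := deriv M)
      (C := iteratedDeriv 2 M x) (h.contDiffOn_deriv.continuousOn.mono hsub)
      ((h.contDiffOn_deriv.differentiableOn (by norm_num)).mono (interior_subset.trans hsub))
      (fun y hy => by
        have hy' := interior_subset hy
        rw [(h.hasDerivAt_deriv (hsub hy')).deriv]
        exact h.antitoneOn_deriv_two (hsub hy') hx hy'.2)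
      (x / 2) (left_mem_Icc.2 (by linarith)) x (right_mem_Icc.2 (by linarith)) (by linarith)
    have h2 := h.deriv_nonneg (half_pos hx)
    linarith

theorem affine_const (h : M.Admissible 2 q C) {x₀ a b : ℝ} (hx₀ : 0 < x₀)
    (hlin : ∀ x, x₀ ≤ x → M x = a * x + b) : b = -1 := by
  have hder : ∀ x, 0 < x → M.rightDeriv x = deriv M x := fun x hx => by
    rw [rightDeriv, if_pos hx]
    exact (h.hasDerivAt hx).hasDerivWithinAt.derivWithin (uniqueDiffWithinAt_Ioi x)
  have hst : ∀ x, 0 < x → M.monotone_rightDeriv.stieltjesFunction x = deriv M x := fun x hx => by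
    rw [Monotone.stieltjesFunction_eq]
    have hc : ContinuousAt M.rightDeriv x := by
      refine (h.hasDerivAt_deriv hx).continuousAt.congr ?_
      filter_upwards [Ioi_mem_nhds hx] with y hy using (hder y hy).symm
    rw [ContinuousWithinAt.rightLim_eq hc.continuousWithinAt, hder x hx]
  have htop : Tendsto M.monotone_rightDeriv.stieltjesFunction atTop (𝓝 a) := by
    refine tendsto_const_nhds.congr' ?_
    filter_upwards [Ioi_mem_atTop x₀] with x hx
    rw [hst x (hx₀.trans hx), (M.deriv_eq_of_affine hlin hx).1]
  have hmeas : ∀ x, 0 < x → M.stieltjesMeasure (Ioi x) = ENNReal.ofReal (a - deriv M x) :=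
    fun x hx => by rw [stieltjesMeasure, StieltjesFunction.measure_Ioi _ htop, hst x hx]
  have h1 : ∫⁻ x in Ioi (0 : ℝ), ENNReal.ofReal x ∂M.stieltjesMeasure =
      ∫⁻ t in Ioi (0 : ℝ), ENNReal.ofReal (a - deriv M t) := by
    rw [lintegral_eq_lintegral_meas_lt (f := fun x : ℝ => x) (M.stieltjesMeasure.restrict (Ioi 0))
      ((ae_restrict_iff' measurableSet_Ioi).2 (.of_forall fun x hx => le_of_lt hx))
      aemeasurable_id]
    refine setLIntegral_congr_fun measurableSet_Ioi fun t ht => ?_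
    have ht : 0 < t := ht
    change M.stieltjesMeasure.restrict (Ioi 0) (Ioi t) = _
    rw [Measure.restrict_apply measurableSet_Ioi,
      inter_eq_left.2 (Ioi_subset_Ioi ht.le), hmeas t ht]
  have hnorm := h.normalized
  rw [IsNormalized, h1, lintegral_Ioi_of_hasDerivAt (g := fun t => a * t - M t) (l := -b)] at hnorm
  · rw [M.map_zero, ENNReal.ofReal_eq_one] at hnorm
    linarith
  · exact (continuousWithinAt_const.mul continuousWithinAt_id).sub
      h.deriv_zero.continuousWithinAt
  · intro x hx
    exact (((hasDerivAt_id x).const_mul a).sub (h.hasDerivAt hx)).congr_deriv (by simp)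
  · intro x hx
    have hx : 0 < x := hx
    have h3 := M.monotone_rightDeriv (le_max_left x (x₀ + 1))
    rw [hder x hx, hder _ (lt_max_of_lt_left hx),
      (M.deriv_eq_of_affine hlin (lt_max_of_lt_right (lt_add_one x₀))).1] at h3
    linarith
  · refine tendsto_const_nhds.congr' ?_
    filter_upwards [Ici_mem_atTop x₀] with x hx
    rw [hlin x hx]
    ring

theorem continuousOn_density (h : M.Admissible 2 q C) :
    ContinuousOn (M.density 2) (Ioi 0) := by
  have h1 : ContinuousOn (fun s : ℝ => -(1 / 2 * (s ^ 4)⁻¹ * iteratedDeriv 3 M s⁻¹)) (Ioi 0) := by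
    refine ((continuousOn_const.mul ((continuousOn_id.pow 4).inv₀ ?_)).mul
      (h.continuousOn_deriv_three.comp (continuousOn_id.inv₀ ?_) ?_)).neg
    · intro x hx
      exact pow_ne_zero _ (ne_of_gt hx)
    · intro x hx
      exact ne_of_gt hx
    · intro x hx
      exact inv_pos.2 (show (0 : ℝ) < x from hx)
  exact h1.congr fun s _ => density_two M s

theorem lintegral_law (h : M.Admissible 2 q C) {φ : ℝ → ℝ≥0∞} (hφ : Measurable φ) :
    ∫⁻ x, φ x ∂M.law 2 = ∫⁻ s in Ioi 0, ENNReal.ofReal (M.density 2 s) * φ s := by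
  rw [law, lintegral_withDensity_eq_lintegral_mul₀ _ hφ.aemeasurable]
  · rfl
  · exact (h.continuousOn_density.aemeasurable measurableSet_Ioi).ennreal_ofReal

theorem _root_.OrliczEmbedding.OrliczFunction.density_eq_zero (M : OrliczFunction) {x₀ a b : ℝ}
    (hlin : ∀ x, x₀ ≤ x → M x = a * x + b) {s : ℝ} (hs : x₀ < s⁻¹) : M.density 2 s = 0 := by
  rw [density_two, (M.deriv_eq_of_affine hlin hs).2.2]
  simp

theorem lintegral_law_eq (h : M.Admissible 2 q C) {x₀ a b ε : ℝ}
    (hlin : ∀ x, x₀ ≤ x → M x = a * x + b) (hε : 0 < ε) (hx₀ : x₀ < ε⁻¹) {φ : ℝ → ℝ≥0∞}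
    (hφ : Measurable φ) :
    ∫⁻ x, φ x ∂M.law 2 = ∫⁻ s in Ioi ε, ENNReal.ofReal (M.density 2 s) * φ s := by
  rw [h.lintegral_law hφ, ← Ioc_union_Ioi_eq_Ioi hε.le,
    lintegral_union measurableSet_Ioi (Ioc_disjoint_Ioi le_rfl)]
  have : ∫⁻ s in Ioc 0 ε, ENNReal.ofReal (M.density 2 s) * φ s = 0 := by
    refine setLIntegral_eq_zero measurableSet_Ioc fun s hs => ?_
    have h1 : x₀ < s⁻¹ := hx₀.trans_le (inv_anti₀ hs.1 hs.2)
    simp [M.density_eq_zero hlin h1]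
  rw [this, zero_add]

/-- An antiderivative of the density. -/
noncomputable def _root_.OrliczEmbedding.OrliczFunction.tailPrimitive (M : OrliczFunction)
    (s : ℝ) : ℝ :=
  M s⁻¹ - s⁻¹ * deriv M s⁻¹ + 1 / 2 * (s⁻¹ * (s⁻¹ * iteratedDeriv 2 M s⁻¹))

/-- An antiderivative of `s ↦ s * M.density 2 s`. -/
noncomputable def _root_.OrliczEmbedding.OrliczFunction.tailMeanPrimitive (M : OrliczFunction)
    (s : ℝ) : ℝ :=
  1 / 2 * (s⁻¹ * iteratedDeriv 2 M s⁻¹ - deriv M s⁻¹)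

theorem hasDerivAt_tailPrimitive (h : M.Admissible 2 q C) {s : ℝ} (hs : 0 < s) :
    HasDerivAt M.tailPrimitive (M.density 2 s) s := by
  have hi := hasDerivAt_inv hs.ne'
  have hs' := inv_pos.2 hs
  have h0 := (h.hasDerivAt hs').comp s hi
  have h1 := (h.hasDerivAt_deriv hs').comp s hi
  have h2 := (h.hasDerivAt_deriv_two hs').comp s hi
  refine ((h0.sub (hi.mul h1)).add ((hi.mul (hi.mul h2)).const_mul (1 / 2))).congr_deriv ?_
  rw [density_two]
  simp only [Function.comp, Pi.mul_apply]
  field_simp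
  ring

theorem hasDerivAt_tailMeanPrimitive (h : M.Admissible 2 q C) {s : ℝ} (hs : 0 < s) :
    HasDerivAt M.tailMeanPrimitive (s * M.density 2 s) s := by
  have hi := hasDerivAt_inv hs.ne'
  have hs' := inv_pos.2 hs
  have h1 := (h.hasDerivAt_deriv hs').comp s hi
  have h2 := (h.hasDerivAt_deriv_two hs').comp s hi
  refine (((hi.mul h2).sub h1).const_mul (1 / 2)).congr_deriv ?_
  rw [density_two]
  simp only [Function.comp]
  field_simp
  ring

theorem hasDerivAt_deriv_two_inv (h : M.Admissible 2 q C) {s : ℝ} (hs : 0 < s) :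
    HasDerivAt (fun s => 1 / 2 * iteratedDeriv 2 M s⁻¹) (s ^ 2 * M.density 2 s) s := by
  have hi := hasDerivAt_inv hs.ne'
  have h2 := (h.hasDerivAt_deriv_two (inv_pos.2 hs)).comp s hi
  refine (h2.const_mul (1 / 2)).congr_deriv ?_
  rw [density_two]
  field_simp

theorem tendsto_tailPrimitive (h : M.Admissible 2 q C) :
    Tendsto M.tailPrimitive atTop (𝓝 0) := by
  have hi := tendsto_inv_atTop_nhdsGT_zero (𝕜 := ℝ)
  have hi' : Tendsto (fun s : ℝ => s⁻¹) atTop (𝓝 0) := tendsto_inv_atTop_zero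
  have := ((h.tendsto_zero.comp hi).sub (hi'.mul (h.tendsto_deriv_zero.comp hi))).add
    ((hi'.mul (h.tendsto_mul_deriv_two_zero.comp hi)).const_mul (1 / 2))
  simp only [mul_zero, sub_zero, add_zero] at this
  exact this

theorem tendsto_tailMeanPrimitive (h : M.Admissible 2 q C) :
    Tendsto M.tailMeanPrimitive atTop (𝓝 0) := by
  have hi := tendsto_inv_atTop_nhdsGT_zero (𝕜 := ℝ)
  have := ((h.tendsto_mul_deriv_two_zero.comp hi).sub (h.tendsto_deriv_zero.comp hi)).const_mul
    (1 / 2 : ℝ)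
  simp only [mul_zero, sub_zero] at this
  exact this

theorem isProbabilityMeasure_law (h : M.Admissible 2 q C) : IsProbabilityMeasure (M.law 2) := by
  obtain ⟨x₀, hx₀, a, b, hlin⟩ := h.linear
  have hb := h.affine_const hx₀ hlin
  have hε : 0 < (x₀ + 1)⁻¹ := by positivity
  have hε' : x₀ < ((x₀ + 1)⁻¹)⁻¹ := by
    rw [inv_inv]
    exact lt_add_one x₀
  constructor
  rw [← lintegral_one, h.lintegral_law_eq hlin hε hε' measurable_const]
  simp only [mul_one]
  rw [lintegral_Ioi_of_hasDerivAt
    (h.hasDerivAt_tailPrimitive hε).continuousAt.continuousWithinAt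
    (fun x hx => h.hasDerivAt_tailPrimitive (hε.trans hx))
    (fun x hx => h.density_nonneg x (hε.trans hx)) h.tendsto_tailPrimitive]
  obtain ⟨h1, h2, -⟩ := M.deriv_eq_of_affine hlin (lt_add_one x₀)
  rw [tailPrimitive, inv_inv, h1, h2, hlin _ (lt_add_one x₀).le, hb]
  norm_num
  ring

/-- The function equal to `x ^ 2` for `x ≤ 1` and to `2 * x - 1` for `x ≥ 1`. -/
noncomputable def _root_.OrliczEmbedding.huber (x : ℝ) : ℝ := if x ≤ 1 then x ^ 2 else 2 * x - 1

theorem _root_.OrliczEmbedding.measurable_huber : Measurable huber :=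
  Measurable.ite measurableSet_Iic (by fun_prop) (by fun_prop)

theorem _root_.OrliczEmbedding.trunc_one_le_huber {x : ℝ} (hx : 0 ≤ x) :
    trunc 1 x ≤ huber x := by
  rw [trunc, Real.rpow_one, abs_of_nonneg hx, huber]
  split_ifs with h
  · exact min_le_left _ _
  · exact (min_le_right _ _).trans (by linarith)

theorem _root_.OrliczEmbedding.huber_le_two_mul_trunc {x : ℝ} (hx : 0 ≤ x) :
    huber x ≤ 2 * trunc 1 x := by
  rw [trunc, Real.rpow_one, abs_of_nonneg hx, huber]
  split_ifs with h
  · rw [min_eq_left (by nlinarith)]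
    nlinarith
  · rw [min_eq_right (by nlinarith)]
    linarith

/-- An admissible Orlicz function is an average of dilates of the Huber function. -/
theorem lintegral_huber (h : M.Admissible 2 q C) {v : ℝ} (hv : 0 < v) :
    ∫⁻ x, ENNReal.ofReal (huber (v * x)) ∂M.law 2 = ENNReal.ofReal (M v) := by
  obtain ⟨x₀, hx₀, a, b, hlin⟩ := h.linear
  have hv' : 0 < v⁻¹ := inv_pos.2 hv
  set ε := (v + x₀)⁻¹ with hεdef
  have hε : 0 < ε := by positivity
  have hεi : ε⁻¹ = v + x₀ := inv_inv _
  have hε' : x₀ < ε⁻¹ := by linarith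
  have hεv : ε ≤ v⁻¹ := inv_anti₀ hv (by linarith)
  rw [h.lintegral_law_eq hlin hε hε' (φ := fun x => ENNReal.ofReal (huber (v * x)))
    (measurable_huber.comp (measurable_const_mul v)).ennreal_ofReal,
    ← Ioc_union_Ioi_eq_Ioi hεv, lintegral_union measurableSet_Ioi (Ioc_disjoint_Ioi le_rfl)]
  have h1 : ∫⁻ s in Ioc ε v⁻¹, ENNReal.ofReal (M.density 2 s) * ENNReal.ofReal (huber (v * s)) =
      ENNReal.ofReal (v ^ 2 * (1 / 2 * iteratedDeriv 2 M v)) := by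
    have e : ∫⁻ s in Ioc ε v⁻¹, ENNReal.ofReal (M.density 2 s) * ENNReal.ofReal (huber (v * s)) =
        ∫⁻ s in Ioc ε v⁻¹, ENNReal.ofReal (v ^ 2 * (s ^ 2 * M.density 2 s)) := by
      refine setLIntegral_congr_fun measurableSet_Ioc fun s hs => ?_
      have hle : v * s ≤ 1 := by
        have := mul_le_mul_of_nonneg_left hs.2 hv.le
        rwa [mul_inv_cancel₀ hv.ne'] at this
      rw [← ENNReal.ofReal_mul (h.density_nonneg s (hε.trans hs.1)), huber, if_pos hle]
      congr 1
      ring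
    have hsub : Icc ε v⁻¹ ⊆ Ioi 0 := fun s hs => hε.trans_le hs.1
    rw [e, lintegral_Ioc_of_hasDerivAt hεv
      (fun s hs => (h.hasDerivAt_deriv_two_inv (hsub hs)).const_mul (v ^ 2))]
    · simp only [inv_inv]
      rw [(M.deriv_eq_of_affine hlin hε').2.1]
      simp
    · exact continuousOn_const.mul ((continuousOn_id.pow 2).mul (h.continuousOn_density.mono hsub))
    · intro s hs
      have := h.density_nonneg s (hsub hs)
      positivity
  have hgt : ∀ s ∈ Ioi v⁻¹, 1 < v * s := fun s hs => by
    have := mul_lt_mul_of_pos_left (show v⁻¹ < s from hs) hv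
    rwa [mul_inv_cancel₀ hv.ne'] at this
  have hd : ∀ s, 0 < s → HasDerivAt
      (fun s => 2 * v * M.tailMeanPrimitive s - M.tailPrimitive s)
      (2 * v * (s * M.density 2 s) - M.density 2 s) s := fun s hs =>
    ((h.hasDerivAt_tailMeanPrimitive hs).const_mul _).sub (h.hasDerivAt_tailPrimitive hs)
  have hpos : ∀ s ∈ Ioi v⁻¹, 0 ≤ 2 * v * (s * M.density 2 s) - M.density 2 s := fun s hs => by
    have h3 := h.density_nonneg s (hv'.trans hs)
    have h4 := hgt s hs
    have : 2 * v * (s * M.density 2 s) - M.density 2 s = (2 * (v * s) - 1) * M.density 2 s := by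
      ring
    rw [this]
    exact mul_nonneg (by linarith) h3
  have hlim : Tendsto (fun s => 2 * v * M.tailMeanPrimitive s - M.tailPrimitive s) atTop
      (𝓝 0) := by
    simpa using (h.tendsto_tailMeanPrimitive.const_mul (2 * v)).sub h.tendsto_tailPrimitive
  have hval : 0 - (2 * v * M.tailMeanPrimitive v⁻¹ - M.tailPrimitive v⁻¹) =
      M v - v ^ 2 * (1 / 2 * iteratedDeriv 2 M v) := by
    simp only [tailPrimitive, tailMeanPrimitive, inv_inv]
    ring
  have h2 : ∫⁻ s in Ioi v⁻¹, ENNReal.ofReal (M.density 2 s) * ENNReal.ofReal (huber (v * s)) =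
      ENNReal.ofReal (M v - v ^ 2 * (1 / 2 * iteratedDeriv 2 M v)) := by
    have e : ∫⁻ s in Ioi v⁻¹, ENNReal.ofReal (M.density 2 s) * ENNReal.ofReal (huber (v * s)) =
        ∫⁻ s in Ioi v⁻¹, ENNReal.ofReal (2 * v * (s * M.density 2 s) - M.density 2 s) := by
      refine setLIntegral_congr_fun measurableSet_Ioi fun s hs => ?_
      rw [← ENNReal.ofReal_mul (h.density_nonneg s (hv'.trans hs)), huber,
        if_neg (not_le.2 (hgt s hs))]
      congr 1
      ring
    rw [e, lintegral_Ioi_of_hasDerivAt (hd _ hv').continuousAt.continuousWithinAt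
      (fun s hs => hd s (hv'.trans hs)) hpos hlim, hval]
  have hnn : 0 ≤ M v - v ^ 2 * (1 / 2 * iteratedDeriv 2 M v) :=
    (sub_nonneg_of_hasDerivAt (hd _ hv').continuousAt.continuousWithinAt
      (fun s hs => hd s (hv'.trans hs)) hpos hlim).trans_eq hval
  rw [h1, h2, ← ENNReal.ofReal_add _ hnn]
  · congr 1
    ring
  · have := h.deriv_two_nonneg hv
    positivity

end OrliczFunction.Admissible

theorem lintegral_Ioc_rpow {r w : ℝ} (hr : -1 < r) (hw : 0 ≤ w) :
    ∫⁻ t in Ioc 0 w, ENNReal.ofReal (t ^ r) = ENNReal.ofReal (w ^ (r + 1) / (r + 1)) := by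
  have hint := intervalIntegral.intervalIntegrable_rpow' (a := 0) (b := w) hr
  rw [← ofReal_integral_eq_lintegral_ofReal
    ((intervalIntegrable_iff_integrableOn_Ioc_of_le hw).1 hint)
    ((ae_restrict_iff' measurableSet_Ioc).2 (.of_forall fun t ht => Real.rpow_nonneg ht.1.le _)),
    ← intervalIntegral.integral_of_le hw, integral_rpow (Or.inl hr),
    Real.zero_rpow (by linarith), sub_zero]

theorem lintegral_Ioi_rpow {r w : ℝ} (hr : r < -1) (hw : 0 < w) :
    ∫⁻ t in Ioi w, ENNReal.ofReal (t ^ r) = ENNReal.ofReal (-w ^ (r + 1) / (r + 1)) := by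
  rw [← ofReal_integral_eq_lintegral_ofReal (integrableOn_Ioi_rpow_of_lt hr hw)
    ((ae_restrict_iff' measurableSet_Ioi).2
      (.of_forall fun t ht => Real.rpow_nonneg (hw.trans ht).le _)),
    integral_Ioi_rpow_of_lt hr hw]

theorem trunc_abs_mul (p c x : ℝ) : trunc p (|c| * x) = trunc p (c * x) := by
  simp only [trunc, mul_pow, sq_abs, abs_mul, abs_abs]

theorem trunc_zero {p : ℝ} : trunc p 0 = 0 :=
  le_antisymm ((min_le_left _ _).trans (by simp)) (trunc_nonneg _ _)

theorem abs_le_one_add_trunc (x : ℝ) : |x| ≤ 1 + trunc 1 x := by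
  rw [trunc_one_eq]
  rcases le_total |x| 1 with h | h
  · rw [min_eq_left h]
    nlinarith [abs_nonneg x]
  · rw [min_eq_right h]
    linarith

theorem integrable_of_lintegral_trunc {Ω : Type*} [MeasurableSpace Ω] {μ : Measure Ω}
    [IsFiniteMeasure μ] {Y : Ω → ℝ} (hm : Measurable Y)
    (h : ∫⁻ ω, ENNReal.ofReal (trunc 1 (Y ω)) ∂μ ≠ ∞) : Integrable Y μ := by
  have h1 : Integrable (fun ω => trunc 1 (Y ω)) μ :=
    (lintegral_ofReal_ne_top_iff_integrable
      ((measurable_trunc 1).comp hm).aestronglyMeasurable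
      (.of_forall fun ω => trunc_nonneg _ _)).1 h
  refine ((integrable_const (1 : ℝ)).add h1).mono hm.aestronglyMeasurable (.of_forall fun ω => ?_)
  refine (abs_le_one_add_trunc _).trans ?_
  exact le_abs_self _

theorem trunc_mul_le {q v x : ℝ} (hv : 0 < v) (hx : 0 < x) :
    trunc q (v * x) ≤ v ^ q * (x ^ 2 * min v x⁻¹ ^ (2 - q)) := by
  rcases le_total v x⁻¹ with h | h
  · rw [min_eq_left h]
    refine (min_le_left _ _).trans_eq ?_
    rw [mul_left_comm, ← Real.rpow_add hv, add_sub_cancel, Real.rpow_two]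
    ring
  · rw [min_eq_right h]
    refine (min_le_right _ _).trans_eq ?_
    rw [abs_of_pos (by positivity), Real.mul_rpow hv.le hx.le, Real.inv_rpow hx.le,
      ← Real.rpow_neg hx.le, ← Real.rpow_two, ← Real.rpow_add hx]
    congr 2
    ring

theorem ofReal_trunc_le_lintegral {q v x : ℝ} (hq2 : q < 2) (hv : 0 < v) (hx : 0 < x) :
    ENNReal.ofReal (trunc q (v * x)) ≤ ENNReal.ofReal ((2 - q) * v ^ q) *
      ∫⁻ t in Ioc 0 v, ENNReal.ofReal (t ^ (-q - 1)) * ENNReal.ofReal (trunc 1 (t * x)) := by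
  have hw : 0 < min v x⁻¹ := lt_min hv (inv_pos.2 hx)
  have h1 : ENNReal.ofReal (x ^ 2 * (min v x⁻¹ ^ (2 - q) / (2 - q))) ≤
      ∫⁻ t in Ioc 0 v, ENNReal.ofReal (t ^ (-q - 1)) * ENNReal.ofReal (trunc 1 (t * x)) := by
    refine le_trans (le_of_eq ?_) (lintegral_mono_set (Ioc_subset_Ioc_right (min_le_left v x⁻¹)))
    have e : ∫⁻ t in Ioc 0 (min v x⁻¹), ENNReal.ofReal (t ^ (-q - 1)) *
        ENNReal.ofReal (trunc 1 (t * x)) =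
        ∫⁻ t in Ioc 0 (min v x⁻¹), ENNReal.ofReal (x ^ 2) * ENNReal.ofReal (t ^ (1 - q)) := by
      refine setLIntegral_congr_fun measurableSet_Ioc fun t ht => ?_
      have ht0 : 0 < t := ht.1
      have hle : t * x ≤ 1 := by
        have := mul_le_mul_of_nonneg_right (ht.2.trans (min_le_right _ _)) hx.le
        rwa [inv_mul_cancel₀ hx.ne'] at this
      rw [← ENNReal.ofReal_mul (by positivity), ← ENNReal.ofReal_mul (by positivity), trunc_one_eq,
        abs_of_pos (by positivity), min_eq_left hle]
      congr 1
      rw [show (1 : ℝ) - q = (-q - 1) + 2 by ring, Real.rpow_add ht0, Real.rpow_two]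
      ring
    rw [e, lintegral_const_mul' _ _ ENNReal.ofReal_ne_top, lintegral_Ioc_rpow (by linarith) hw.le,
      ← ENNReal.ofReal_mul (by positivity), show (1 : ℝ) - q + 1 = 2 - q by ring]
  refine le_trans ?_ (mul_le_mul_right h1 _)
  have h2 : 0 < 2 - q := by linarith
  rw [← ENNReal.ofReal_mul (by positivity)]
  refine ENNReal.ofReal_le_ofReal ((trunc_mul_le hv hx).trans_eq ?_)
  field_simp

namespace OrliczFunction

variable {M : OrliczFunction} {q C : ℝ}

theorem ae_law_pos (M : OrliczFunction) (p : ℝ) : ∀ᵐ x ∂M.law p, 0 < x :=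
  (withDensity_absolutelyContinuous _ _).ae_le (ae_restrict_mem measurableSet_Ioi)

theorem le_inv_one (M : OrliczFunction) {v : ℝ} (hv : 0 ≤ v) (h : M v ≤ 1) : v ≤ M.inv 1 := by
  refine le_csSup ⟨max 1 (M 1)⁻¹, ?_⟩ ⟨hv, h⟩
  rintro t ⟨ht0, ht⟩
  rcases le_total t 1 with h1 | h1
  · exact h1.trans (le_max_left _ _)
  · refine le_trans ?_ (le_max_right _ _)
    have htp : 0 < t := by linarith
    have hM := M.pos 1 one_pos
    have h2 := M.mul_le (c := t⁻¹) (t := t) (by positivity) (inv_le_one_of_one_le₀ h1) ht0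
    rw [inv_mul_cancel₀ htp.ne', inv_mul_eq_div, le_div_iff₀ htp] at h2
    rw [← one_div, le_div_iff₀ hM]
    linarith

namespace Admissible

theorem lintegral_trunc_one_le (h : M.Admissible 2 q C) {v : ℝ} (hv : 0 ≤ v) :
    ∫⁻ x, ENNReal.ofReal (trunc 1 (v * x)) ∂M.law 2 ≤ ENNReal.ofReal (M v) := by
  rcases hv.eq_or_lt with rfl | hv
  · simp [trunc_zero]
  · rw [← h.lintegral_huber hv]
    refine lintegral_mono_ae ?_
    filter_upwards [M.ae_law_pos 2] with x hx
    exact ENNReal.ofReal_le_ofReal (trunc_one_le_huber (by positivity))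

theorem ofReal_le_lintegral_trunc_one (h : M.Admissible 2 q C) {v : ℝ} (hv : 0 ≤ v) :
    ENNReal.ofReal (M v) ≤ 2 * ∫⁻ x, ENNReal.ofReal (trunc 1 (v * x)) ∂M.law 2 := by
  rcases hv.eq_or_lt with rfl | hv
  · simp [M.map_zero]
  · rw [← h.lintegral_huber hv, ← lintegral_const_mul' _ _ ENNReal.ofNat_ne_top]
    refine lintegral_mono_ae ?_
    filter_upwards [M.ae_law_pos 2] with x hx
    rw [← ENNReal.ofReal_ofNat, ← ENNReal.ofReal_mul zero_le_two]
    exact ENNReal.ofReal_le_ofReal (huber_le_two_mul_trunc (by positivity))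

theorem lintegral_trunc_le (h : M.Admissible 2 q C) (hq : 1 < q) (hq2 : q < 2) (hC : 0 < C)
    {v : ℝ} (hv : 0 ≤ v) (hv1 : M v ≤ 1) :
    ∫⁻ x, ENNReal.ofReal (trunc q (v * x)) ∂M.law 2 ≤ ENNReal.ofReal (C * M v) := by
  rcases hv.eq_or_lt with rfl | hv
  · simp [trunc_zero]
  have := h.isProbabilityMeasure_law
  obtain ⟨hint, hle⟩ := h.integral v hv (M.le_inv_one hv.le hv1)
  have h1 : ∫⁻ x, ∫⁻ t in Ioc 0 v, ENNReal.ofReal (t ^ (-q - 1)) *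
      ENNReal.ofReal (trunc 1 (t * x)) ∂volume ∂M.law 2 ≤ ENNReal.ofReal (C * (M v / v ^ q)) := by
    rw [lintegral_lintegral_swap]
    · refine le_trans ?_ (ENNReal.ofReal_le_ofReal hle)
      rw [ofReal_integral_eq_lintegral_ofReal hint
        ((ae_restrict_iff' measurableSet_Ioc).2 (.of_forall fun t ht => by
          have := M.nonneg ht.1.le
          have := ht.1
          positivity))]
      refine setLIntegral_mono' measurableSet_Ioc fun t ht => ?_
      have ht0 : 0 < t := ht.1
      rw [lintegral_const_mul' _ _ ENNReal.ofReal_ne_top]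
      refine (mul_le_mul_right (h.lintegral_trunc_one_le ht0.le) _).trans_eq ?_
      rw [← ENNReal.ofReal_mul (by positivity), Real.rpow_sub ht0, Real.rpow_neg ht0.le,
        Real.rpow_one]
      congr 1
      field_simp
    · refine Measurable.aemeasurable ?_
      have h2 : Measurable fun p : ℝ × ℝ => p.2 * p.1 := by fun_prop
      have h3 : Measurable fun p : ℝ × ℝ => ENNReal.ofReal (p.2 ^ (-q - 1)) := by fun_prop
      exact h3.mul ((measurable_trunc 1).comp h2).ennreal_ofReal
  calc ∫⁻ x, ENNReal.ofReal (trunc q (v * x)) ∂M.law 2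
      ≤ ∫⁻ x, ENNReal.ofReal ((2 - q) * v ^ q) * (∫⁻ t in Ioc 0 v, ENNReal.ofReal (t ^ (-q - 1)) *
          ENNReal.ofReal (trunc 1 (t * x))) ∂M.law 2 := by
        refine lintegral_mono_ae ?_
        filter_upwards [M.ae_law_pos 2] with x hx
        exact ofReal_trunc_le_lintegral hq2 hv hx
    _ ≤ ENNReal.ofReal ((2 - q) * v ^ q) * ENNReal.ofReal (C * (M v / v ^ q)) := by
        rw [lintegral_const_mul' _ _ ENNReal.ofReal_ne_top]
        exact mul_le_mul_right h1 _
    _ ≤ ENNReal.ofReal (C * M v) := by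
        have h2 : 0 < 2 - q := by linarith
        rw [← ENNReal.ofReal_mul (by positivity)]
        refine ENNReal.ofReal_le_ofReal ?_
        have e : (2 - q) * v ^ q * (C * (M v / v ^ q)) = (2 - q) * (C * M v) := by
          field_simp
        rw [e]
        have := M.nonneg hv.le
        exact mul_le_of_le_one_left (by positivity) (by linarith)

end Admissible

end OrliczFunction

section Xi

variable {q : ℝ}

theorem lintegral_xiLaw {φ : ℝ → ℝ≥0∞} (hφ : Measurable φ) :
    ∫⁻ x, φ x ∂xiLaw q = ∫⁻ x in Ioi ((q - 1) ^ (1 / q)),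
      ENNReal.ofReal (q * (q - 1) * x ^ (-q - 1)) * φ x := by
  rw [xiLaw, lintegral_withDensity_eq_lintegral_mul₀ _ hφ.aemeasurable,
    restrict_Ioi_eq_restrict_Ici]
  · rfl
  · exact Measurable.aemeasurable (by fun_prop)

theorem isProbabilityMeasure_xiLaw (hq : 1 < q) : IsProbabilityMeasure (xiLaw q) := by
  have hq0 : q ≠ 0 := by linarith
  have hq1 : 0 < q - 1 := by linarith
  have ha : 0 < (q - 1) ^ (1 / q) := by positivity
  constructor
  rw [← lintegral_one, lintegral_xiLaw measurable_const]
  have hd : 0 ≤ q * (q - 1) := by positivity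
  simp only [mul_one, ENNReal.ofReal_mul hd]
  rw [lintegral_const_mul' _ _ ENNReal.ofReal_ne_top, lintegral_Ioi_rpow (by linarith) ha,
    ← ENNReal.ofReal_mul hd, ENNReal.ofReal_eq_one, ← Real.rpow_mul hq1.le,
    show 1 / q * (-q - 1 + 1) = -1 by
      rw [show -q - 1 + 1 = -q by ring, mul_neg, one_div_mul_cancel (by linarith)], Real.rpow_neg_one,
    show -q - 1 + 1 = -q by ring]
  field_simp

theorem lintegral_trunc_xiLaw_le (hq : 1 < q) (hq2 : q < 2) {v : ℝ} (hv : 0 ≤ v) :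
    ∫⁻ x, ENNReal.ofReal (trunc 1 (v * x)) ∂xiLaw q ≤
      ENNReal.ofReal ((q * (q - 1) / (2 - q) + q) * v ^ q) := by
  rcases hv.eq_or_lt with rfl | hv
  · simp [trunc_zero]
  have hq1 : 0 < q - 1 := by linarith
  have hq2' : 0 < 2 - q := by linarith
  have ha : 0 < (q - 1) ^ (1 / q) := by positivity
  have hv' : 0 < v⁻¹ := inv_pos.2 hv
  have hd : 0 ≤ q * (q - 1) := by positivity
  rw [lintegral_xiLaw (φ := fun x => ENNReal.ofReal (trunc 1 (v * x)))
    ((measurable_trunc 1).comp (measurable_const_mul v)).ennreal_ofReal]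
  refine (lintegral_mono_set (Ioi_subset_Ioi ha.le)).trans ?_
  rw [← Ioc_union_Ioi_eq_Ioi hv'.le, lintegral_union measurableSet_Ioi (Ioc_disjoint_Ioi le_rfl),
    add_mul, ENNReal.ofReal_add (by positivity) (by positivity)]
  refine add_le_add ?_ ?_
  · calc _ ≤ ∫⁻ x in Ioc 0 v⁻¹, ENNReal.ofReal (q * (q - 1) * v ^ 2) *
          ENNReal.ofReal (x ^ (1 - q)) := by
          refine setLIntegral_mono' measurableSet_Ioc fun x hx => ?_
          have hx0 : 0 < x := hx.1
          rw [← ENNReal.ofReal_mul (by positivity), ← ENNReal.ofReal_mul (by positivity)]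
          refine ENNReal.ofReal_le_ofReal ?_
          refine (mul_le_mul_of_nonneg_left (min_le_left _ _) (by positivity)).trans_eq ?_
          rw [show (1 : ℝ) - q = (-q - 1) + 2 by ring, Real.rpow_add hx0, Real.rpow_two]
          ring
      _ = _ := by
          rw [lintegral_const_mul' _ _ ENNReal.ofReal_ne_top, lintegral_Ioc_rpow (by linarith) hv'.le,
            ← ENNReal.ofReal_mul (by positivity), show (1 : ℝ) - q + 1 = 2 - q by ring,
            Real.inv_rpow hv.le, Real.rpow_sub hv, Real.rpow_two]
          congr 1
          field_simp
  · calc _ ≤ ∫⁻ x in Ioi v⁻¹, ENNReal.ofReal (q * (q - 1) * v) * ENNReal.ofReal (x ^ (-q)) := by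
          refine setLIntegral_mono' measurableSet_Ioi fun x hx => ?_
          have hx0 : 0 < x := hv'.trans hx
          rw [← ENNReal.ofReal_mul (by positivity), ← ENNReal.ofReal_mul (by positivity)]
          refine ENNReal.ofReal_le_ofReal ?_
          refine (mul_le_mul_of_nonneg_left (trunc_one_le_abs _) (by positivity)).trans_eq ?_
          rw [abs_of_pos (by positivity), show -q = (-q - 1) + 1 by ring, Real.rpow_add hx0,
            Real.rpow_one]
          ring_nf
      _ = _ := by
          rw [lintegral_const_mul' _ _ ENNReal.ofReal_ne_top, lintegral_Ioi_rpow (by linarith) hv',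
            ← ENNReal.ofReal_mul (by positivity), Real.inv_rpow hv.le, ← Real.rpow_neg hv.le,
            show -(-q + 1) = q - 1 by ring, show -q + 1 = -(q - 1) by ring, Real.rpow_sub hv,
            Real.rpow_one]
          congr 1
          field_simp

theorem le_lintegral_trunc_xiLaw (hq : 1 < q) (hq2 : q < 2) {v : ℝ} (hv : 0 ≤ v) (hv1 : v ≤ 1) :
    ENNReal.ofReal (v ^ q) ≤ ∫⁻ x, ENNReal.ofReal (trunc 1 (v * x)) ∂xiLaw q := by
  rcases hv.eq_or_lt with rfl | hv
  · simp [Real.zero_rpow (show q ≠ 0 by linarith)]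
  have hq1 : 0 < q - 1 := by linarith
  have hv' : 0 < v⁻¹ := inv_pos.2 hv
  have ha : (q - 1) ^ (1 / q) ≤ v⁻¹ :=
    (Real.rpow_le_one hq1.le (by linarith) (by positivity)).trans ((one_le_inv₀ hv).2 hv1)
  rw [lintegral_xiLaw (φ := fun x => ENNReal.ofReal (trunc 1 (v * x)))
    ((measurable_trunc 1).comp (measurable_const_mul v)).ennreal_ofReal]
  refine le_trans ?_ (lintegral_mono_set (Ioi_subset_Ioi ha))
  calc ENNReal.ofReal (v ^ q) ≤ ENNReal.ofReal (q * v ^ q) :=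
        ENNReal.ofReal_le_ofReal (le_mul_of_one_le_left (by positivity) hq.le)
    _ = ∫⁻ x in Ioi v⁻¹, ENNReal.ofReal (q * (q - 1) * v) * ENNReal.ofReal (x ^ (-q)) := by
        rw [lintegral_const_mul' _ _ ENNReal.ofReal_ne_top, lintegral_Ioi_rpow (by linarith) hv',
          ← ENNReal.ofReal_mul (by positivity), Real.inv_rpow hv.le, ← Real.rpow_neg hv.le,
          show -(-q + 1) = q - 1 by ring, show -q + 1 = -(q - 1) by ring, Real.rpow_sub hv,
          Real.rpow_one]
        congr 1
        field_simp
    _ = _ := by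
        refine setLIntegral_congr_fun measurableSet_Ioi fun x hx => ?_
        have hx0 : 0 < x := hv'.trans hx
        have hge : 1 ≤ v * x := by
          have := mul_le_mul_of_nonneg_left (le_of_lt hx) hv.le
          rwa [mul_inv_cancel₀ hv.ne'] at this
        rw [← ENNReal.ofReal_mul (by positivity), ← ENNReal.ofReal_mul (by positivity),
          trunc_one_eq, abs_of_pos (by positivity), min_eq_right hge,
          show -q = (-q - 1) + 1 by ring, Real.rpow_add hx0, Real.rpow_one]
        ring_nf

end Xi

theorem lintegral_trunc_comp {Ω : Type*} [MeasurableSpace Ω] {μ : Measure Ω}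
    {ν : Measure ℝ} {Y : Ω → ℝ} (h : HasLaw Y ν μ) (p c : ℝ) :
    ∫⁻ ω, ENNReal.ofReal (trunc p (c * Y ω)) ∂μ = ∫⁻ x, ENNReal.ofReal (trunc p (|c| * x)) ∂ν := by
  rw [h.lintegral_comp (f := fun x => ENNReal.ofReal (trunc p (c * x)))]
  · simp only [trunc_abs_mul]
  · exact ((measurable_trunc p).comp (measurable_const_mul c)).ennreal_ofReal.aemeasurable

theorem ofReal_integral_trunc {Ω : Type*} [MeasurableSpace Ω] {μ : Measure Ω} {Y : Ω → ℝ}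
    (hm : Measurable Y) (hi : Integrable Y μ) :
    ENNReal.ofReal (∫ ω, trunc 1 (Y ω) ∂μ) = ∫⁻ ω, ENNReal.ofReal (trunc 1 (Y ω)) ∂μ := by
  refine ofReal_integral_eq_lintegral_ofReal ?_ (.of_forall fun ω => trunc_nonneg _ _)
  refine hi.mono ((measurable_trunc 1).comp hm).aestronglyMeasurable (.of_forall fun ω => ?_)
  rw [Real.norm_of_nonneg (trunc_nonneg _ _)]
  exact trunc_one_le_abs _

section Levels

variable {Ω : Type*} [MeasurableSpace Ω] {μ : Measure Ω} [IsProbabilityMeasure μ]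
  {ι : Type*} [Fintype ι]

theorem sqrt_sum_sq_eq_mul {t : ℝ} (ht : 0 < t) (c y : ι → ℝ) :
    √(∑ i, (c i * y i) ^ 2) = t * √(∑ i, (c i / t * y i) ^ 2) := by
  rw [← Real.sqrt_sq ht.le, ← Real.sqrt_mul (sq_nonneg t), Real.sqrt_sq ht.le, Finset.mul_sum]
  congr 1
  refine Finset.sum_congr rfl fun i _ => ?_
  field_simp

theorem mul_le_integral_sqrt_sum_sq {Y : ι → Ω → ℝ} (hm : ∀ i, Measurable (Y i))
    (hi : ∀ i, Integrable (Y i) μ) (hind : iIndepFun Y μ) (c : ι → ℝ) {t : ℝ} (ht : 0 < t)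
    (h : 1 / 2 ≤ ∑ i, ∫ ω, trunc 1 (c i / t * Y i ω) ∂μ) :
    2 / 5 * t ≤ ∫ ω, √(∑ i, (c i * Y i ω) ^ 2) ∂μ := by
  have h1 := le_integral_sqrt_sum_sq (Y := fun i ω => c i / t * Y i ω)
    (fun i => (hm i).const_mul _) (fun i => (hi i).const_mul _)
    (hind.comp (fun i x => c i / t * x) fun i => measurable_const_mul _) h
  simp only [sqrt_sum_sq_eq_mul ht c]
  rw [integral_const_mul]
  linarith [mul_le_mul_of_nonneg_left h1 ht.le]

theorem sqrt_rpow_eq {x : ℝ} (hx : 0 ≤ x) (p : ℝ) : √x ^ p = x ^ (p / 2) := by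
  rw [Real.sqrt_eq_rpow, ← Real.rpow_mul hx]
  congr 1
  ring

theorem lintegral_sqrt_sum_sq_rpow_le {Y : ι → Ω → ℝ} (hm : ∀ i, Measurable (Y i)) {p : ℝ}
    (hp : 0 ≤ p) (hp2 : p ≤ 2) (c : ι → ℝ) {t K : ℝ} (ht : 0 < t) (hK : 0 ≤ K)
    (h : ∑ i, ∫⁻ ω, ENNReal.ofReal (trunc p (c i / t * Y i ω)) ∂μ ≤ ENNReal.ofReal K) :
    ∫⁻ ω, ENNReal.ofReal (√(∑ i, (c i * Y i ω) ^ 2) ^ p) ∂μ ≤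
      ENNReal.ofReal ((1 + K) * t ^ p) := by
  calc ∫⁻ ω, ENNReal.ofReal (√(∑ i, (c i * Y i ω) ^ 2) ^ p) ∂μ
      ≤ ∫⁻ ω, ENNReal.ofReal (t ^ p) *
          (1 + ∑ i, ENNReal.ofReal (trunc p (c i / t * Y i ω))) ∂μ := by
        refine lintegral_mono fun ω => ?_
        rw [sqrt_sum_sq_eq_mul ht c, Real.mul_rpow ht.le (Real.sqrt_nonneg _),
          ENNReal.ofReal_mul (by positivity)]
        refine mul_le_mul_right ?_ _
        rw [← ENNReal.ofReal_sum_of_nonneg fun i _ => trunc_nonneg _ _, ← ENNReal.ofReal_one,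
          ← ENNReal.ofReal_add zero_le_one (Finset.sum_nonneg fun i _ => trunc_nonneg _ _),
          sqrt_rpow_eq (Finset.sum_nonneg fun i _ => sq_nonneg _)]
        exact ENNReal.ofReal_le_ofReal (sum_sq_rpow_le hp hp2 _ _)
    _ ≤ _ := by
        have hmt : ∀ i, Measurable fun ω => ENNReal.ofReal (trunc p (c i / t * Y i ω)) :=
          fun i => ((measurable_trunc p).comp ((hm i).const_mul _)).ennreal_ofReal
        rw [lintegral_const_mul' _ _ ENNReal.ofReal_ne_top, lintegral_add_left measurable_const,
          lintegral_finsetSum _ fun i _ => hmt i, lintegral_const, measure_univ, mul_one,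
          mul_comm (1 + K), ENNReal.ofReal_mul (by positivity),
          ENNReal.ofReal_add zero_le_one hK, ENNReal.ofReal_one]
        gcongr

theorem le_ofReal_of_forall_gt {f : ℝ → ℝ} (hf : Continuous f) {L : ℝ≥0∞} {A : ℝ}
    (h : ∀ t, A < t → L ≤ ENNReal.ofReal (f t)) : L ≤ ENNReal.ofReal (f A) := by
  have h1 : Tendsto (fun t => ENNReal.ofReal (f t)) (𝓝[>] A) (𝓝 (ENNReal.ofReal (f A))) :=
    ((ENNReal.continuous_ofReal.comp hf).tendsto A).mono_left nhdsWithin_le_nhds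
  exact ge_of_tendsto h1 (by filter_upwards [self_mem_nhdsWithin] with t ht using h t ht)

section Orlicz

variable {M : OrliczFunction} {q C : ℝ}

theorem OrliczFunction.Admissible.integrable (h : M.Admissible 2 q C) {X : Ω → ℝ}
    (hm : Measurable X) (hlaw : HasLaw X (M.law 2) μ) : Integrable X μ := by
  refine integrable_of_lintegral_trunc hm (ne_top_of_le_ne_top
    (ENNReal.ofReal_ne_top (r := M 1)) ?_)
  have h1 := lintegral_trunc_comp hlaw 1 1
  simp only [one_mul, abs_one] at h1
  rw [h1]
  simpa using h.lintegral_trunc_one_le zero_le_one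

theorem OrliczFunction.Admissible.mul_luxemburg_le (h : M.Admissible 2 q C) {n : ℕ}
    {X : Fin n → Ω → ℝ} (hm : ∀ j, Measurable (X j)) (hlaw : ∀ j, HasLaw (X j) (M.law 2) μ)
    (hind : iIndepFun X μ) (a : Fin n → ℝ) :
    2 / 5 * M.luxemburg a ≤ ∫ ω, √(∑ j, (a j * X j ω) ^ 2) ∂μ := by
  have hi := fun j => h.integrable (hm j) (hlaw j)
  have hnn : 0 ≤ ∫ ω, √(∑ j, (a j * X j ω) ^ 2) ∂μ :=
    integral_nonneg fun ω => Real.sqrt_nonneg _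
  suffices hs : M.luxemburg a ≤ 5 / 2 * ∫ ω, √(∑ j, (a j * X j ω) ^ 2) ∂μ by linarith
  refine le_of_forall_lt_imp_le_of_dense fun t ht => ?_
  rcases le_or_gt t 0 with ht0 | ht0
  · linarith
  have hlt : 1 < ∑ j, M (|a j| / t) := by
    by_contra! hle
    exact notMem_of_lt_csInf ht (M.luxemburg_bddBelow a) ⟨ht0, hle⟩
  suffices hs : 1 / 2 ≤ ∑ j, ∫ ω, trunc 1 (a j / t * X j ω) ∂μ by
    linarith [mul_le_integral_sqrt_sum_sq hm hi hind a ht0 hs]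
  have hle : ∑ j, M (|a j| / t) ≤ ∑ j, 2 * ∫ ω, trunc 1 (a j / t * X j ω) ∂μ := by
    refine Finset.sum_le_sum fun j _ => ?_
    have h1 := h.ofReal_le_lintegral_trunc_one (v := |a j| / t) (by positivity)
    rw [← abs_of_pos ht0, ← abs_div, ← lintegral_trunc_comp (hlaw j), abs_div, abs_of_pos ht0,
      ← ofReal_integral_trunc ((hm j).const_mul _) ((hi j).const_mul _), ← ENNReal.ofReal_ofNat,
      ← ENNReal.ofReal_mul zero_le_two] at h1
    exact (ENNReal.ofReal_le_ofReal_iff (mul_nonneg zero_le_two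
      (integral_nonneg fun ω => trunc_nonneg _ _))).1 h1
  rw [← Finset.mul_sum] at hle
  linarith

theorem OrliczFunction.sum_le_one_of_luxemburg_lt (M : OrliczFunction) {n : ℕ} {a : Fin n → ℝ}
    {t : ℝ} (ht : M.luxemburg a < t) : ∑ j, M (|a j| / t) ≤ 1 := by
  obtain ⟨s, ⟨hs, hsa⟩, hst⟩ := exists_lt_of_csInf_lt (M.luxemburg_nonempty a) ht
  refine (Finset.sum_le_sum fun j _ => M.mono ?_ ?_).trans hsa
  · have := hs.trans hst
    positivity
  · gcongr

theorem OrliczFunction.Admissible.lintegral_rpow_le (h : M.Admissible 2 q C) (hq : 1 < q)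
    (hq2 : q < 2) (hC : 0 < C) {n : ℕ} {X : Fin n → Ω → ℝ} (hm : ∀ j, Measurable (X j))
    (hlaw : ∀ j, HasLaw (X j) (M.law 2) μ) (a : Fin n → ℝ) :
    ∫⁻ ω, ENNReal.ofReal (√(∑ j, (a j * X j ω) ^ 2) ^ q) ∂μ ≤
      ENNReal.ofReal ((1 + C) * M.luxemburg a ^ q) := by
  refine le_ofReal_of_forall_gt (f := fun t => (1 + C) * t ^ q)
    (continuous_const.mul (Real.continuous_rpow_const (by linarith))) fun t ht => ?_
  have ht0 : 0 < t := (M.luxemburg_nonneg a).trans_lt ht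
  have hsum := M.sum_le_one_of_luxemburg_lt ht
  refine lintegral_sqrt_sum_sq_rpow_le hm (by linarith) hq2.le a ht0 hC.le ?_
  have hnn : ∀ j, 0 ≤ M (|a j| / t) := fun j => M.nonneg (by positivity)
  calc ∑ j, ∫⁻ ω, ENNReal.ofReal (trunc q (a j / t * X j ω)) ∂μ
      ≤ ∑ j, ENNReal.ofReal (C * M (|a j| / t)) := by
        refine Finset.sum_le_sum fun j _ => ?_
        rw [lintegral_trunc_comp (hlaw j), abs_div, abs_of_pos ht0]
        refine h.lintegral_trunc_le hq hq2 hC (by positivity) ?_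
        exact (Finset.single_le_sum (f := fun j => M (|a j| / t)) (fun j _ => hnn j)
          (Finset.mem_univ j)).trans hsum
    _ = ENNReal.ofReal (C * ∑ j, M (|a j| / t)) := by
        rw [Finset.mul_sum, ENNReal.ofReal_sum_of_nonneg fun j _ => mul_nonneg hC.le (hnn j)]
    _ ≤ _ := ENNReal.ofReal_le_ofReal (mul_le_of_le_one_right hC.le hsum)

end Orlicz

section Xi

variable {q : ℝ} {ξ : ι → Ω → ℝ}

theorem integrable_xi (hq : 1 < q) (hq2 : q < 2) {Y : Ω → ℝ} (hm : Measurable Y)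
    (hlaw : HasLaw Y (xiLaw q) μ) : Integrable Y μ := by
  refine integrable_of_lintegral_trunc hm ?_
  have h1 := lintegral_trunc_comp hlaw 1 1
  simp only [one_mul, abs_one] at h1
  rw [h1]
  have h2 := lintegral_trunc_xiLaw_le hq hq2 zero_le_one
  simp only [one_mul] at h2
  exact ne_top_of_le_ne_top ENNReal.ofReal_ne_top h2

theorem sum_abs_div_rpow {q : ℝ} (b : ι → ℝ) {t : ℝ} (ht : 0 < t) :
    ∑ i, (|b i| / t) ^ q = (∑ i, |b i| ^ q) / t ^ q := by
  rw [Finset.sum_div]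
  exact Finset.sum_congr rfl fun i _ => Real.div_rpow (abs_nonneg _) ht.le _

theorem mul_sum_rpow_le_integral_xi (hq : 1 < q) (hq2 : q < 2) (hm : ∀ i, Measurable (ξ i))
    (hlaw : ∀ i, HasLaw (ξ i) (xiLaw q) μ) (hind : iIndepFun ξ μ) (b : ι → ℝ) :
    2 / 5 * (∑ i, |b i| ^ q) ^ (1 / q) ≤ ∫ ω, √(∑ i, (b i * ξ i ω) ^ 2) ∂μ := by
  have hi := fun i => integrable_xi hq hq2 (hm i) (hlaw i)
  have hS : 0 ≤ ∑ i, |b i| ^ q := Finset.sum_nonneg fun i _ => by positivity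
  rcases hS.eq_or_lt with h0 | h0
  · rw [← h0, Real.zero_rpow (by positivity), mul_zero]
    exact integral_nonneg fun ω => Real.sqrt_nonneg _
  set t := (∑ i, |b i| ^ q) ^ (1 / q) with ht
  have ht0 : 0 < t := by positivity
  have htq : t ^ q = ∑ i, |b i| ^ q := by
    rw [ht, ← Real.rpow_mul hS, one_div_mul_cancel (by positivity), Real.rpow_one]
  refine mul_le_integral_sqrt_sum_sq hm hi hind b ht0 ?_
  have hsum : ∑ i, (|b i| / t) ^ q = 1 := by
    rw [sum_abs_div_rpow b ht0, htq, div_self h0.ne']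
  refine le_trans (by norm_num : (1 / 2 : ℝ) ≤ 1) (hsum.ge.trans ?_)
  refine Finset.sum_le_sum fun i _ => ?_
  have hle : |b i| / t ≤ 1 := by
    by_contra! hlt
    refine (Real.one_lt_rpow hlt (show 0 < q by linarith)).not_ge (le_of_le_of_eq ?_ hsum)
    exact Finset.single_le_sum (f := fun i => (|b i| / t) ^ q) (fun j _ => by positivity)
      (Finset.mem_univ i)
  have h1 := le_lintegral_trunc_xiLaw hq hq2 (v := |b i| / t) (by positivity) hle
  rw [← abs_of_pos ht0, ← abs_div, ← lintegral_trunc_comp (hlaw i), abs_div, abs_of_pos ht0,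
    ← ofReal_integral_trunc ((hm i).const_mul _) ((hi i).const_mul _)] at h1
  exact (ENNReal.ofReal_le_ofReal_iff (integral_nonneg fun ω => trunc_nonneg _ _)).1 h1

theorem lintegral_xi_le (hq : 1 < q) (hq2 : q < 2) (hm : ∀ i, Measurable (ξ i))
    (hlaw : ∀ i, HasLaw (ξ i) (xiLaw q) μ) (b : ι → ℝ) :
    ∫⁻ ω, ENNReal.ofReal √(∑ i, (b i * ξ i ω) ^ 2) ∂μ ≤
      ENNReal.ofReal ((1 + (q * (q - 1) / (2 - q) + q)) * (∑ i, |b i| ^ q) ^ (1 / q)) := by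
  have hq1 : 0 < q - 1 := by linarith
  have hq2' : 0 < 2 - q := by linarith
  set K := q * (q - 1) / (2 - q) + q with hK
  have hK0 : 0 ≤ K := by positivity
  have hS : 0 ≤ ∑ i, |b i| ^ q := Finset.sum_nonneg fun i _ => by positivity
  refine le_ofReal_of_forall_gt (f := fun t => (1 + K) * t) (by fun_prop) fun t ht => ?_
  have ht0 : 0 < t := (by positivity : (0 : ℝ) ≤ _).trans_lt ht
  have h1 := lintegral_sqrt_sum_sq_rpow_le (p := 1) hm zero_le_one one_le_two b ht0 hK0 (μ := μ) ?_
  · simpa only [Real.rpow_one] using h1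
  have hsum : ∑ i, (|b i| / t) ^ q ≤ 1 := by
    rw [sum_abs_div_rpow b ht0, div_le_one (by positivity)]
    have := Real.rpow_le_rpow (by positivity) ht.le (show 0 ≤ q by linarith)
    rwa [← Real.rpow_mul hS, one_div_mul_cancel (by positivity), Real.rpow_one] at this
  calc ∑ i, ∫⁻ ω, ENNReal.ofReal (trunc 1 (b i / t * ξ i ω)) ∂μ
      ≤ ∑ i, ENNReal.ofReal (K * (|b i| / t) ^ q) := by
        refine Finset.sum_le_sum fun i _ => ?_
        rw [lintegral_trunc_comp (hlaw i), abs_div, abs_of_pos ht0]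
        exact lintegral_trunc_xiLaw_le hq hq2 (by positivity)
    _ = ENNReal.ofReal (K * ∑ i, (|b i| / t) ^ q) := by
        rw [Finset.mul_sum, ENNReal.ofReal_sum_of_nonneg fun i _ => by positivity]
    _ ≤ _ := ENNReal.ofReal_le_ofReal (mul_le_of_le_one_right hK0 hsum)

end Xi

end Levels

theorem exists_iid {ι : Type*} [Fintype ι] (ν : Measure ℝ) [IsProbabilityMeasure ν] :
    ∃ Y : ι → I → ℝ, (∀ i, Measurable (Y i)) ∧ (∀ i, HasLaw (Y i) ν volume) ∧
      iIndepFun Y volume := by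
  obtain ⟨f, hf, hmap⟩ := (Measure.pi fun _ : ι => ν).exists_measurable_map_eq
  have hm : ∀ i, Measurable fun t => f t i := fun i => (measurable_pi_apply i).comp hf
  have hlaw : ∀ i, volume.map (fun t => f t i) = ν := fun i => by
    rw [← (measurePreserving_eval (fun _ : ι => ν) i).map_eq, ← hmap,
      Measure.map_map (measurable_pi_apply i) hf]
    rfl
  refine ⟨fun i t => f t i, hm, fun i => ⟨(hm i).aemeasurable, hlaw i⟩, ?_⟩
  rw [iIndepFun_iff_map_fun_eq_pi_map fun i => (hm i).aemeasurable]
  simp only [hlaw]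
  exact hmap

instance : IsProbabilityMeasure rademacherLaw :=
  ⟨by simp [rademacherLaw, ENNReal.inv_two_add_inv_two]⟩

theorem exists_isSystem {q C : ℝ} (hq : 1 < q) {M : OrliczFunction} (h : M.Admissible 2 q C)
    (n : ℕ) : ∃ (r : Fin n → Fin n → I → ℝ) (ξ X : Fin n → I → ℝ), IsSystem q M r ξ X := by
  have := h.isProbabilityMeasure_law
  have := isProbabilityMeasure_xiLaw hq
  obtain ⟨r, hr, hrl, hri⟩ := exists_iid (ι := Fin n × Fin n) rademacherLaw
  obtain ⟨ξ, hξ, hξl, hξi⟩ := exists_iid (ι := Fin n) (xiLaw q)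
  obtain ⟨X, hX, hXl, hXi⟩ := exists_iid (ι := Fin n) (M.law 2)
  exact ⟨fun i j => r (i, j), ξ, X, fun i j => hr _, hξ, hX, fun i j => hrl _, hξl, hXl, hri, hξi,
    hXi⟩

section Embedding

variable {q C : ℝ} {M : OrliczFunction} {n : ℕ} {r : Fin n → Fin n → I → ℝ} {ξ X : Fin n → I → ℝ}

/-- The Euclidean norm `(∑ j, (a i j * X j u) ^ 2) ^ (1 / 2)` of the `i`-th row. -/
noncomputable def rowNorm (X : Fin n → I → ℝ) (a : MatrixSpace q M n) (i : Fin n) (u : I) : ℝ :=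
  √(∑ j, (a i j * X j u) ^ 2)

theorem rowNorm_nonneg (X : Fin n → I → ℝ) (a : MatrixSpace q M n) (i : Fin n) (u : I) :
    0 ≤ rowNorm X a i u := Real.sqrt_nonneg _

theorem measurable_rowNorm (hX : ∀ j, Measurable (X j)) (a : MatrixSpace q M n) (i : Fin n) :
    Measurable (rowNorm X a i) := by
  unfold rowNorm
  fun_prop

theorem IsSystem.measurable_psi (hs : IsSystem q M r ξ X) (a : MatrixSpace q M n) :
    Measurable (psi r ξ X a) := by
  have h1 := hs.measurable_r
  have h2 := hs.measurable_ξ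
  have h3 := hs.measurable_X
  unfold psi
  fun_prop

theorem sum_prod_sq_eq (ξ X : Fin n → I → ℝ) (a : MatrixSpace q M n) (s u : I) :
    ∑ ij : Fin n × Fin n, (a ij.1 ij.2 * ξ ij.1 s * X ij.2 u) ^ 2 =
      ∑ i, (rowNorm X a i u * ξ i s) ^ 2 := by
  rw [Fintype.sum_prod_type]
  refine Finset.sum_congr rfl fun i _ => ?_
  rw [mul_pow, rowNorm, Real.sq_sqrt (Finset.sum_nonneg fun j _ => sq_nonneg _), Finset.sum_mul]
  exact Finset.sum_congr rfl fun j _ => by ring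

theorem IsSystem.lintegral_psi (hs : IsSystem q M r ξ X) (a : MatrixSpace q M n) (s u : I) :
    ENNReal.ofReal (1 / 2 * √(∑ i, (rowNorm X a i u * ξ i s) ^ 2)) ≤
        ∫⁻ t, ‖psi r ξ X a (t, s, u)‖ₑ ∧
      ∫⁻ t, ‖psi r ξ X a (t, s, u)‖ₑ ≤
        ENNReal.ofReal √(∑ i, (rowNorm X a i u * ξ i s) ^ 2) := by
  obtain ⟨h1, h2, h3⟩ := khintchine (r := fun ij : Fin n × Fin n => r ij.1 ij.2)
    (fun ij => hs.measurable_r _ _) (fun ij => hs.law_r _ _) hs.indep_r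
    (fun ij => a ij.1 ij.2 * ξ ij.1 s * X ij.2 u)
  have e : ∀ t, ∑ ij : Fin n × Fin n, a ij.1 ij.2 * ξ ij.1 s * X ij.2 u * r ij.1 ij.2 t =
      psi r ξ X a (t, s, u) := fun t => by
    rw [Fintype.sum_prod_type, psi]
    refine Finset.sum_congr rfl fun i _ => Finset.sum_congr rfl fun j _ => ?_
    ring
  simp only [e, sum_prod_sq_eq] at h1 h2 h3
  rw [← ofReal_integral_norm_eq_lintegral_enorm h1]
  exact ⟨ENNReal.ofReal_le_ofReal h2, ENNReal.ofReal_le_ofReal h3⟩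

theorem IsSystem.lintegral_psi_eq (hs : IsSystem q M r ξ X) (a : MatrixSpace q M n) :
    ∫⁻ z, ‖psi r ξ X a z‖ₑ = ∫⁻ u, ∫⁻ s, ∫⁻ t, ‖psi r ξ X a (t, s, u)‖ₑ := by
  have hm := (hs.measurable_psi a).enorm
  rw [Measure.volume_eq_prod, lintegral_prod_symm _ hm.aemeasurable, Measure.volume_eq_prod,
    lintegral_prod_symm _ hm.lintegral_prod_left'.aemeasurable]

theorem norm_matrixSpace [hq : Fact (1 < q)] (a : MatrixSpace q M n) :
    ‖a‖ = (∑ i, M.luxemburg (a i) ^ q) ^ (1 / q) := by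
  have e : (ENNReal.ofReal q).toReal = q := ENNReal.toReal_ofReal (by linarith [hq.out])
  rw [PiLp.norm_eq_sum (by rw [e]; linarith [hq.out]), e]
  rfl

theorem le_lintegral_norm_rowNorm [hq : Fact (1 < q)] (hs : IsSystem q M r ξ X)
    (h : M.Admissible 2 q C) (a : MatrixSpace q M n) :
    ENNReal.ofReal (2 / 5 * ‖a‖) ≤
      ∫⁻ u, ENNReal.ofReal ((∑ i, |rowNorm X a i u| ^ q) ^ (1 / q)) := by
  have hq0 : 0 < q := by linarith [hq.out]
  have e : (ENNReal.ofReal q).toReal = q := ENNReal.toReal_ofReal hq0.le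
  have he : 0 < (ENNReal.ofReal q).toReal := by rwa [e]
  set B : I → PiLp (ENNReal.ofReal q) (fun _ : Fin n => ℝ) :=
    fun u => WithLp.toLp _ fun i => rowNorm X a i u with hB
  have hBi : ∀ i, Integrable (fun u => B u i) := fun i =>
    integrable_sqrt_sum_sq (fun j => (hs.measurable_X j).const_mul _)
      fun j => (h.integrable (hs.measurable_X j) (hs.law_X j)).const_mul _
  have hBint : Integrable B := Integrable.of_eval_piLp hBi
  have hnorm : ∀ u, (∑ i, |rowNorm X a i u| ^ q) ^ (1 / q) = ‖B u‖ := fun u => by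
    rw [PiLp.norm_eq_sum he, e]
    rfl
  simp only [hnorm]
  rw [← ofReal_integral_eq_lintegral_ofReal hBint.norm (.of_forall fun u => norm_nonneg _)]
  refine ENNReal.ofReal_le_ofReal (le_trans ?_ (norm_integral_le_integral_norm B))
  have hc : ∀ i, 2 / 5 * M.luxemburg (a i) ≤ ‖(∫ u, B u) i‖ := fun i => by
    rw [eval_integral_piLp hBi]
    exact (h.mul_luxemburg_le hs.measurable_X hs.law_X hs.indep_X (a i)).trans (le_abs_self _)
  rw [norm_matrixSpace, PiLp.norm_eq_sum he, e]
  have hnn : ∀ i, 0 ≤ M.luxemburg (a i) := fun i => M.luxemburg_nonneg _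
  calc 2 / 5 * (∑ i, M.luxemburg (a i) ^ q) ^ (1 / q)
      = (∑ i, (2 / 5 * M.luxemburg (a i)) ^ q) ^ (1 / q) := by
        simp only [Real.mul_rpow (show (0 : ℝ) ≤ 2 / 5 by norm_num) (hnn _)]
        rw [← Finset.mul_sum, Real.mul_rpow (by positivity)
          (Finset.sum_nonneg fun i _ => Real.rpow_nonneg (hnn i) _),
          ← Real.rpow_mul (by norm_num), mul_one_div_cancel hq0.ne', Real.rpow_one]
    _ ≤ _ := by
        refine Real.rpow_le_rpow (Finset.sum_nonneg fun i _ =>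
          Real.rpow_nonneg (mul_nonneg (by norm_num) (hnn i)) _)
          (Finset.sum_le_sum fun i _ => ?_) (by positivity)
        exact Real.rpow_le_rpow (mul_nonneg (by norm_num) (hnn i)) (hc i) hq0.le

theorem rpow_one_div_le_mul {q t S : ℝ} (hq : 1 < q) (ht : 0 < t) (hS : 0 ≤ S) :
    S ^ (1 / q) ≤ t * (1 + S / t ^ q) := by
  have h1 : (S / t ^ q) ^ (1 / q) = S ^ (1 / q) / t := by
    rw [Real.div_rpow hS (by positivity), ← Real.rpow_mul ht.le, mul_one_div_cancel (by linarith),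
      Real.rpow_one]
  have hx : 0 ≤ S / t ^ q := by positivity
  have h2 : (S / t ^ q) ^ (1 / q) ≤ 1 + S / t ^ q := by
    refine (Real.rpow_le_rpow hx (le_add_of_nonneg_left zero_le_one) (by positivity)).trans ?_
    conv_rhs => rw [← Real.rpow_one (1 + S / t ^ q)]
    exact Real.rpow_le_rpow_of_exponent_le (by linarith) ((div_le_one (by linarith)).2 hq.le)
  rw [h1, div_le_iff₀ ht] at h2
  linarith

theorem lintegral_norm_rowNorm_le [hq : Fact (1 < q)] (hq2 : q < 2) (hC : 0 < C)
    (hs : IsSystem q M r ξ X) (h : M.Admissible 2 q C) (a : MatrixSpace q M n) :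
    ∫⁻ u, ENNReal.ofReal ((∑ i, |rowNorm X a i u| ^ q) ^ (1 / q)) ≤
      ENNReal.ofReal ((2 + C) * ‖a‖) := by
  have hq0 : 0 < q := by linarith [hq.out]
  refine le_ofReal_of_forall_gt (f := fun t => (2 + C) * t) (by fun_prop) fun t ht => ?_
  have ht0 : 0 < t := (norm_nonneg a).trans_lt ht
  have hnn : ∀ i, 0 ≤ M.luxemburg (a i) ^ q := fun i =>
    Real.rpow_nonneg (M.luxemburg_nonneg _) _
  have hS : 0 ≤ ∑ i, M.luxemburg (a i) ^ q := Finset.sum_nonneg fun i _ => hnn i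
  have hle : (∑ i, M.luxemburg (a i) ^ q) ≤ t ^ q := by
    rw [norm_matrixSpace] at ht
    have := Real.rpow_le_rpow (by positivity) ht.le hq0.le
    rwa [← Real.rpow_mul hS, one_div_mul_cancel hq0.ne', Real.rpow_one] at this
  have hmb : ∀ i, Measurable fun u => ENNReal.ofReal (rowNorm X a i u ^ q) := fun i =>
    ((measurable_rowNorm hs.measurable_X a i).pow_const q).ennreal_ofReal
  calc ∫⁻ u, ENNReal.ofReal ((∑ i, |rowNorm X a i u| ^ q) ^ (1 / q))
      ≤ ∫⁻ u, (ENNReal.ofReal t + ENNReal.ofReal (t / t ^ q) *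
          ∑ i, ENNReal.ofReal (rowNorm X a i u ^ q)) := by
        refine lintegral_mono fun u => ?_
        simp only [abs_of_nonneg (rowNorm_nonneg X a _ u)]
        have hS' : 0 ≤ ∑ i, rowNorm X a i u ^ q :=
          Finset.sum_nonneg fun i _ => Real.rpow_nonneg (rowNorm_nonneg X a i u) _
        rw [← ENNReal.ofReal_sum_of_nonneg fun i _ =>
          Real.rpow_nonneg (rowNorm_nonneg X a i u) _, ← ENNReal.ofReal_mul (by positivity),
          ← ENNReal.ofReal_add ht0.le (by positivity)]
        refine ENNReal.ofReal_le_ofReal ((rpow_one_div_le_mul hq.out ht0 hS').trans_eq ?_)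
        ring
    _ = ENNReal.ofReal t + ENNReal.ofReal (t / t ^ q) *
          ∑ i, ∫⁻ u, ENNReal.ofReal (rowNorm X a i u ^ q) := by
        rw [lintegral_add_left measurable_const, lintegral_const, measure_univ, mul_one,
          lintegral_const_mul' _ _ ENNReal.ofReal_ne_top, lintegral_finsetSum _ fun i _ => hmb i]
    _ ≤ ENNReal.ofReal t + ENNReal.ofReal (t / t ^ q) *
          ∑ i, ENNReal.ofReal ((1 + C) * M.luxemburg (a i) ^ q) := by
        gcongr with i
        exact h.lintegral_rpow_le hq.out hq2 hC hs.measurable_X hs.law_X (a i)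
    _ ≤ ENNReal.ofReal ((2 + C) * t) := by
        have hCC : 0 ≤ 1 + C := by linarith
        rw [← ENNReal.ofReal_sum_of_nonneg fun i _ => mul_nonneg hCC (hnn i), ← Finset.mul_sum,
          ← ENNReal.ofReal_mul (by positivity), ← ENNReal.ofReal_add ht0.le (by positivity)]
        refine ENNReal.ofReal_le_ofReal ?_
        have h1 : t / t ^ q * ((1 + C) * ∑ i, M.luxemburg (a i) ^ q) ≤
            t / t ^ q * ((1 + C) * t ^ q) := by gcongr
        have h2 : t / t ^ q * ((1 + C) * t ^ q) = (1 + C) * t := by field_simp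
        linarith

/-- The constant in the upper estimate, for fixed `q` and `C`. -/
noncomputable def upperConst (q C : ℝ) : ℝ := (1 + (q * (q - 1) / (2 - q) + q)) * (2 + C)

theorem upperConst_pos (hq : 1 < q) (hq2 : q < 2) (hC : 0 < C) : 0 < upperConst q C := by
  have hq1 : 0 < q - 1 := by linarith
  have hq2' : 0 < 2 - q := by linarith
  unfold upperConst
  positivity

theorem le_lintegral_psi [hq : Fact (1 < q)] (hq2 : q < 2) (hs : IsSystem q M r ξ X)
    (h : M.Admissible 2 q C) (a : MatrixSpace q M n) :
    ENNReal.ofReal (2 / 25 * ‖a‖) ≤ ∫⁻ z, ‖psi r ξ X a z‖ₑ := by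
  rw [hs.lintegral_psi_eq]
  have h1 : ∀ u, ENNReal.ofReal (1 / 5) *
      ENNReal.ofReal ((∑ i, |rowNorm X a i u| ^ q) ^ (1 / q)) ≤
      ∫⁻ s, ∫⁻ t, ‖psi r ξ X a (t, s, u)‖ₑ := fun u => by
    refine le_trans ?_ (lintegral_mono fun s => (hs.lintegral_psi a s u).1)
    have hi : Integrable fun s => √(∑ i, (rowNorm X a i u * ξ i s) ^ 2) :=
      integrable_sqrt_sum_sq (fun i => (hs.measurable_ξ i).const_mul _)
        fun i => (integrable_xi hq.out hq2 (hs.measurable_ξ i) (hs.law_ξ i)).const_mul _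
    rw [← ofReal_integral_eq_lintegral_ofReal (hi.const_mul _)
      (.of_forall fun s => mul_nonneg (by norm_num) (Real.sqrt_nonneg _)), integral_const_mul,
      ← ENNReal.ofReal_mul (by norm_num)]
    refine ENNReal.ofReal_le_ofReal ?_
    have := mul_sum_rpow_le_integral_xi hq.out hq2 hs.measurable_ξ hs.law_ξ hs.indep_ξ
      fun i => rowNorm X a i u
    linarith
  refine le_trans ?_ (lintegral_mono h1)
  rw [lintegral_const_mul' _ _ ENNReal.ofReal_ne_top]
  refine le_trans (le_of_eq ?_) (mul_le_mul_right (le_lintegral_norm_rowNorm hs h a) _)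
  rw [← ENNReal.ofReal_mul (by norm_num)]
  congr 1
  ring

theorem lintegral_psi_le [hq : Fact (1 < q)] (hq2 : q < 2) (hC : 0 < C) (hs : IsSystem q M r ξ X)
    (h : M.Admissible 2 q C) (a : MatrixSpace q M n) :
    ∫⁻ z, ‖psi r ξ X a z‖ₑ ≤ ENNReal.ofReal (upperConst q C * ‖a‖) := by
  have hq0 : 0 < q := by linarith [hq.out]
  have hq1 : 0 < q - 1 := by linarith [hq.out]
  have hq2' : 0 < 2 - q := by linarith
  have hK : 0 ≤ 1 + (q * (q - 1) / (2 - q) + q) := by positivity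
  rw [hs.lintegral_psi_eq]
  have h1 : ∀ u, ∫⁻ s, ∫⁻ t, ‖psi r ξ X a (t, s, u)‖ₑ ≤
      ENNReal.ofReal (1 + (q * (q - 1) / (2 - q) + q)) *
        ENNReal.ofReal ((∑ i, |rowNorm X a i u| ^ q) ^ (1 / q)) := fun u => by
    refine (lintegral_mono fun s => (hs.lintegral_psi a s u).2).trans ?_
    rw [← ENNReal.ofReal_mul hK]
    exact lintegral_xi_le hq.out hq2 hs.measurable_ξ hs.law_ξ fun i => rowNorm X a i u
  refine (lintegral_mono h1).trans ?_
  rw [lintegral_const_mul' _ _ ENNReal.ofReal_ne_top]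
  refine (mul_le_mul_right (lintegral_norm_rowNorm_le hq2 hC hs h a) _).trans_eq ?_
  rw [← ENNReal.ofReal_mul hK, upperConst, mul_assoc]

theorem exists_embedding [hq : Fact (1 < q)] (hq2 : q < 2) (hC : 0 < C) (hs : IsSystem q M r ξ X)
    (h : M.Admissible 2 q C) :
    ∃ Ψ : MatrixSpace q M n →L[ℝ] Lp ℝ 1 (volume : Measure (I × I × I)),
      (∀ a, Ψ a =ᵐ[volume] psi r ξ X a) ∧
      ∀ a, 2 / 25 * ‖a‖ ≤ ‖Ψ a‖ ∧ ‖Ψ a‖ ≤ upperConst q C * ‖a‖ := by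
  have hc := upperConst_pos hq.out hq2 hC
  have hint : ∀ a : MatrixSpace q M n, Integrable (psi r ξ X a) := fun a =>
    ⟨(hs.measurable_psi a).aestronglyMeasurable,
      (lintegral_psi_le hq2 hC hs h a).trans_lt ENNReal.ofReal_lt_top⟩
  have hadd : ∀ a b : MatrixSpace q M n, psi r ξ X (a + b) = psi r ξ X a + psi r ξ X b :=
    fun a b => by
    ext z
    simp only [psi, Pi.add_apply, ← Finset.sum_add_distrib]
    refine Finset.sum_congr rfl fun i _ => Finset.sum_congr rfl fun j _ => ?_
    change (a i j + b i j) * _ * _ * _ = _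
    ring
  have hsmul : ∀ (c : ℝ) (a : MatrixSpace q M n), psi r ξ X (c • a) = c • psi r ξ X a :=
    fun c a => by
    ext z
    simp only [psi, Pi.smul_apply, smul_eq_mul, Finset.mul_sum]
    refine Finset.sum_congr rfl fun i _ => Finset.sum_congr rfl fun j _ => ?_
    change (c * a i j) * _ * _ * _ = _
    ring
  have hnorm : ∀ a : MatrixSpace q M n, ‖(hint a).toL1 (psi r ξ X a)‖ =
      (∫⁻ z, ‖psi r ξ X a z‖ₑ).toReal := fun a => Integrable.norm_toL1_eq_lintegral_enorm _ _
  have hupper : ∀ a : MatrixSpace q M n,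
      ‖(hint a).toL1 (psi r ξ X a)‖ ≤ upperConst q C * ‖a‖ := fun a => by
    rw [hnorm]
    exact ENNReal.toReal_le_of_le_ofReal (by positivity) (lintegral_psi_le hq2 hC hs h a)
  let Ψ : MatrixSpace q M n →ₗ[ℝ] Lp ℝ 1 (volume : Measure (I × I × I)) :=
    { toFun := fun a => (hint a).toL1 (psi r ξ X a)
      map_add' := fun a b => by
        rw [← Integrable.toL1_add]
        exact (Integrable.toL1_eq_toL1_iff _ _ _ _).2 (.of_eq (hadd a b))
      map_smul' := fun c a => by
        rw [RingHom.id_apply, ← Integrable.toL1_smul]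
        exact (Integrable.toL1_eq_toL1_iff _ _ _ _).2 (.of_eq (hsmul c a)) }
  refine ⟨Ψ.mkContinuous _ hupper, fun a => (hint a).coeFn_toL1, fun a => ⟨?_, hupper a⟩⟩
  change _ ≤ ‖(hint a).toL1 (psi r ξ X a)‖
  rw [hnorm]
  refine (ENNReal.ofReal_le_iff_le_toReal ?_).1 (le_lintegral_psi hq2 hs h a)
  exact (lintegral_psi_le hq2 hC hs h a).trans_lt ENNReal.ofReal_lt_top |>.ne

theorem exists_submodule_banachMazurDist_le {E F : Type*} [NormedAddCommGroup E] [NormedSpace ℝ E]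
    [FiniteDimensional ℝ E] [NormedAddCommGroup F] [NormedSpace ℝ F] (Ψ : E →L[ℝ] F) {c₁ c₂ : ℝ}
    (hc₁ : 0 < c₁) (hc₂ : 0 ≤ c₂) (h : ∀ x, c₁ * ‖x‖ ≤ ‖Ψ x‖ ∧ ‖Ψ x‖ ≤ c₂ * ‖x‖) :
    ∃ Y : Submodule ℝ F, Module.finrank ℝ Y = Module.finrank ℝ E ∧
      banachMazurDist E Y ≤ ENNReal.ofReal (c₂ * c₁⁻¹) := by
  have hinj : Function.Injective (Ψ : E →ₗ[ℝ] F) := by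
    refine (injective_iff_map_eq_zero _).2 fun x hx => ?_
    have h1 := (h x).1
    rw [show Ψ x = 0 from hx, norm_zero] at h1
    exact norm_le_zero_iff.1 (nonpos_of_mul_nonpos_right h1 hc₁)
  let T₀ := LinearEquiv.ofInjective (Ψ : E →ₗ[ℝ] F) hinj
  let T := T₀.toContinuousLinearEquiv
  have hT : ∀ x, ‖T x‖ = ‖Ψ x‖ := fun x => rfl
  refine ⟨LinearMap.range (Ψ : E →ₗ[ℝ] F), T₀.finrank_eq.symm, (iInf_le _ T).trans ?_⟩
  rw [ENNReal.ofReal_mul hc₂]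
  refine mul_le_mul' ?_ ?_
  · rw [← ofReal_norm]
    refine ENNReal.ofReal_le_ofReal (ContinuousLinearMap.opNorm_le_bound _ hc₂ fun x => ?_)
    exact (h x).2
  · rw [← ofReal_norm]
    refine ENNReal.ofReal_le_ofReal
      (ContinuousLinearMap.opNorm_le_bound _ (inv_nonneg.2 hc₁.le) fun y => ?_)
    have h1 := (h (T.symm y)).1
    rw [← hT, T.apply_symm_apply] at h1
    rw [inv_mul_eq_div, le_div_iff₀ hc₁, mul_comm]
    exact h1

end Embedding

end OrliczEmbedding

theorem mainTheorem4 (q : ℝ) [Fact (1 < q)] (hq2 : q < 2) :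
    ∃ c₁ : ℝ, 0 < c₁ ∧ ∀ C : ℝ, 0 < C → ∃ c₂ : ℝ, 0 < c₂ ∧
      ∀ M : OrliczFunction, M.Admissible 2 q C →
        IsProbabilityMeasure (M.law 2) ∧
        (∀ n : ℕ, ∃ (r : Fin n → Fin n → I → ℝ) (ξ X : Fin n → I → ℝ), IsSystem q M r ξ X) ∧
        (∀ (n : ℕ) (r : Fin n → Fin n → I → ℝ) (ξ X : Fin n → I → ℝ), IsSystem q M r ξ X →
          ∃ Ψ : MatrixSpace q M n →L[ℝ] Lp ℝ 1 (volume : Measure (I × I × I)),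
            (∀ a, Ψ a =ᵐ[volume] psi r ξ X a) ∧
            ∀ a, c₁ * ‖a‖ ≤ ‖Ψ a‖ ∧ ‖Ψ a‖ ≤ c₂ * ‖a‖) ∧
        EmbedsUniformly (fun n => MatrixSpace q M n)
          (Lp ℝ 1 (volume : Measure (I × I × I))) := by
  have hq : 1 < q := Fact.out
  refine ⟨2 / 25, by norm_num, fun C hC => ⟨upperConst q C, upperConst_pos hq hq2 hC,
    fun M h => ⟨h.isProbabilityMeasure_law, exists_isSystem hq h,
      fun n r ξ X hs => exists_embedding hq2 hC hs h,
      Real.toNNReal (upperConst q C * (2 / 25)⁻¹), ?_, fun n => ?_⟩⟩⟩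
  · have := upperConst_pos hq hq2 hC
    exact Real.toNNReal_pos.2 (by positivity)
  · obtain ⟨r, ξ, X, hs⟩ := exists_isSystem hq h n
    obtain ⟨Ψ, -, hΨ⟩ := exists_embedding hq2 hC hs h
    exact exists_submodule_banachMazurDist_le Ψ (by norm_num) (upperConst_pos hq hq2 hC).le hΨ
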